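/- Let $k$ be an algebraically closed field and let $E$ be a finite-dimensional self-injective $k$-algebra. Modules over $E$ are finitely generated left modules; $E^{op}$-modules are finitely generated right $E$-modules. For a $k$-algebra automorphism $\sigma$ of $E$ and an $E$-module $M$, let ${}_\sigma M$ be the $E$-module with the same underlying space and action $a\cdot m=\sigma(a)m$; for an automorphism $\tau$ and an $E^{op}$-module $N$, let $N_\tau$ be the $E^{op}$-module with action $n\cdot a=n\tau(a)$. In particular ${}_\sigma E$ and $E_\tau$ are $E$-$E$-bimodules (that is, $E\otimes_k E^{op}$-modules), and $x\mapsto\sigma^{-1}(x)$ is an isomorphism of bimodules ${}_\sigma E\cong E_{\sigma^{-1}}$. Let $\Omega^n$ denote the $n$-th Heller translate (the kernel of a projective cover, taken $n$ times). Fix an integer $n\ge 1$. (i) Let $\alpha\in\operatorname{Ext}^n_{E\otimes_kE^{op}}(E,{}_\sigma E)$ and let $M$ be an $E$-module. Since $E\otimes_EM\cong M$ and ${}_\sigma E\otimes_EM\cong{}_\sigma M$, there is a class $\alpha\otimes^{\mathbf L}_EM\in\operatorname{Ext}^n_E(M,{}_\sigma M)$. As $\operatorname{Ext}^n_E(M,{}_\sigma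 M)\cong\operatorname{Hom}_{E\text{-stmod}}(\Omega^n_E(M),{}_\sigma M)$, where $E\text{-stmod}$ is the stable module category (morphisms modulo those that factor through a projective module), this class induces a morphism $\Omega_E^n(M)\to{}_\sigma M$ in $E\text{-stmod}$. The module $M$ is called *strongly $\sigma$-periodic of period $n$ relative to $\alpha$* if this morphism is an isomorphism in $E\text{-stmod}$. (ii) Dually, let $\alpha'\in\operatorname{Ext}^n_{E\otimes_kE^{op}}(E,E_\tau)$ and let $N$ be an $E^{op}$-module. Then $N$ is called *strongly $\tau$-periodic of period $n$ relative to $\alpha'$* if the morphism $\Omega^n_{E^{op}}(N)\to N_\tau$ in $E^{op}\text{-stmod}$ induced by $N\otimes^{\mathbf L}_E\alpha'\in\operatorname{Ext}^n_{E^{op}}(N,N_\tau)$ is an isomorphism in $E^{op}\text{-stmod}$. An element $\alpha\in\operatorname{Ext}^n_{E\otimes_kE^{op}}(E,{}_\sigma E)$ is regarded as an element of $\operatorname{Ext}^n_{E\otimes_kE^{op}}(E,E_{\sigma^{-1}})$ through the isomorphism ${}_\sigma E\cong E_{\sigma^{-1}}$ above. An object of a bounded derived category $D^b(E)$ or $D^b(E^{op})$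 is *perfect* if it is isomorphic there to a bounded complex of finitely generated projective modules. **Lemma 4.1.** Let $\sigma$ be a $k$-algebra automorphism of $E$ and let $\alpha\in\operatorname{Ext}^n_{E\otimes_kE^{op}}(E,{}_\sigma E)$, regarded as a morphism $E\to{}_\sigma E[n]$ in the bounded derived category $D^b(E\otimes_kE^{op})$ of $E$-$E$-bimodules. Let $Y$ be a cocone of $\alpha$, i.e. an object of $D^b(E\otimes_kE^{op})$ that fits into a distinguished triangle $$Y\longrightarrow E\overset{\alpha}{\longrightarrow}{}_\sigma E[n]\longrightarrow Y[1].$$ Then, for every $E$-module $M$, $M$ is strongly $\sigma$-periodic of period $n$ relative to $\alpha$ if and only if $Y\otimes^{\mathbf L}_EM$ is a perfect object of $D^b(E)$. Dually, for every $E^{op}$-module $N$, $N$ is strongly $\sigma^{-1}$-periodic of period $n$ relative to $\alpha$ if and only if $N\otimes^{\mathbf L}_EY$ is a perfect object of $D^b(E^{op})$. -/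

import Mathlib

open CategoryTheory CategoryTheory.Limits CategoryTheory.Abelian
open scoped TensorProduct

universe w w' w₁ w₂ w₃ v v' u u'

namespace StrongPeriodicity

/-! ### Left derived functors on the bounded above derived category -/

section Derived
variable {C : Type u} [Category.{v} C] [Abelian C]

open CochainComplex in
/-- In an abelian category with enough projectives, every bounded above complex admits a
quasi-isomorphism from a bounded above complex of projectives. -/
theorem exists_projective_quasiIso [EnoughProjectives C] (K : CochainComplex C ℤ) (d : ℤ)
    [K.IsStrictlyLE d] :
    ∃ (P : CochainComplex C ℤ) (f : P ⟶ K), QuasiIso f ∧ P.IsStrictlyLE d ∧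
      ∀ i, Projective (P.X i) := by
  let L := (opEquivalence C).functor.obj (Opposite.op K)
  have : L.IsStrictlyGE (-d) := by
    rw [isStrictlyGE_iff]
    intro i hi
    exact (K.isZero_of_isStrictlyLE d (-i) (by lia)).op
  obtain ⟨I, j, hj, hI, hI'⟩ := Plus.modelCategoryQuillen.exists_quasiIso_injective L (-d)
  let e := ChainComplex.cochainComplexEquivalence Cᵒᵖ
  have hg : QuasiIso (e.inverse.map j) := by
    refine ⟨fun i => ?_⟩
    rw [quasiIsoAt_iff' _ (i + 1) i (i - 1) (by simp) (by simp)]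
    have h := (quasiIsoAt_iff' j (-(i + 1)) (-i) (-(i - 1))
      (by simp; lia) (by simp; lia)).1 inferInstance
    exact h
  have key : ∀ (K' : ChainComplex Cᵒᵖ ℤ) (g : e.inverse.obj (e.functor.obj K') ⟶ e.inverse.obj I),
      QuasiIso g → QuasiIso (e.unitIso.hom.app K' ≫ g) := fun K' g hg => inferInstance
  let φ : K.op ⟶ e.inverse.obj I := e.unitIso.hom.app K.op ≫ e.inverse.map j
  have hφ : QuasiIso φ := key K.op (e.inverse.map j) hg
  have hψ := (HomologicalComplex.quasiIso_unopFunctor_map_iff φ).2 hφ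
  let P : CochainComplex C ℤ := (e.inverse.obj I).unop
  refine ⟨P, (HomologicalComplex.unopFunctor _ _).map φ.op, hψ, ?_, ?_⟩
  · rw [isStrictlyLE_iff]
    intro i hi
    exact (I.isZero_of_isStrictlyGE (-d) (-i) (by lia)).unop
  · intro i
    have := hI (-i)
    exact inferInstanceAs (Projective (Opposite.unop (I.X (-i))))

variable [HasDerivedCategory.{w} C]

open DerivedCategory

theorem exists_projective_iso [EnoughProjectives C] (X : DerivedCategory.Minus C) :
    ∃ P : CochainComplex C ℤ, (∃ d : ℤ, P.IsStrictlyLE d) ∧ (∀ i, Projective (P.X i)) ∧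
      Nonempty (Q.obj P ≅ X.obj) := by
  obtain ⟨X, d, ⟨K, e, hK⟩⟩ := X
  obtain ⟨P, f, hf, hP, hP'⟩ := exists_projective_quasiIso K d
  exact ⟨P, ⟨d, hP⟩, hP', ⟨asIso (Q.map f) ≪≫ e.symm⟩⟩

variable [EnoughProjectives C]

/-- A chosen projective resolution of `X`: a bounded above complex of projective objects
which is isomorphic to `X` in the derived category. -/
noncomputable def projRes (X : DerivedCategory.Minus C) : CochainComplex C ℤ :=
  (exists_projective_iso X).choose

/-- The isomorphism between `X` and its chosen projective resolution. -/
noncomputable def projResIso (X : DerivedCategory.Minus C) :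
    Qh.obj ((HomotopyCategory.quotient C (.up ℤ)).obj (projRes X)) ≅ X.obj :=
  (quotientCompQhIso C).app _ ≪≫ (exists_projective_iso X).choose_spec.2.2.some

/-- Morphisms in the derived category out of a bounded above complex of projectives are
homotopy classes of maps of complexes. -/
theorem Qh_map_bijective (X : DerivedCategory.Minus C) (L : HomotopyCategory C (.up ℤ)) :
    Function.Bijective (Qh.map :
      ((HomotopyCategory.quotient C (.up ℤ)).obj (projRes X) ⟶ L) → _) := by
  obtain ⟨⟨d, hd⟩, hP, -⟩ := (exists_projective_iso X).choose_spec
  have : (projRes X).IsStrictlyLE d := hd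
  have : ∀ i, Projective ((projRes X).X i) := hP
  have : (projRes X).IsKProjective := CochainComplex.isKProjective_of_projective _ d
  exact CochainComplex.IsKProjective.Qh_map_bijective _ _

/-- For `f : X ⟶ L` in the derived category, the unique homotopy class of maps of complexes from
the projective resolution of `X` to `L` which represents `f`. -/
noncomputable def projResLift {X : DerivedCategory.Minus C} {L : HomotopyCategory C (.up ℤ)}
    (f : X.obj ⟶ Qh.obj L) : (HomotopyCategory.quotient C (.up ℤ)).obj (projRes X) ⟶ L :=
  ((Qh_map_bijective X L).surjective ((projResIso X).hom ≫ f)).choose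

@[simp] theorem Qh_map_projResLift {X : DerivedCategory.Minus C}
    {L : HomotopyCategory C (.up ℤ)} (f : X.obj ⟶ Qh.obj L) :
    Qh.map (projResLift f) = (projResIso X).hom ≫ f :=
  ((Qh_map_bijective X L).surjective ((projResIso X).hom ≫ f)).choose_spec

/-- The projective resolution functor from the bounded above derived category to the homotopy
category. -/
noncomputable def projResFunctor : DerivedCategory.Minus C ⥤ HomotopyCategory C (.up ℤ) where
  obj X := (HomotopyCategory.quotient C (.up ℤ)).obj (projRes X)
  map {X Y} f := projResLift (f.hom ≫ (projResIso Y).inv)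
  map_id X := (Qh_map_bijective _ _).injective (by simp)
  map_comp f g := (Qh_map_bijective _ _).injective (by simp)

variable {D : Type u'} [Category.{v'} D] [Abelian D] [HasDerivedCategory.{w'} D]
  (F : C ⥤ D) [F.Additive]

/-- The total left derived functor of the additive functor `F` on the bounded above derived
category: replace a complex by a projective resolution and apply `F` termwise. -/
noncomputable def leftDerived : DerivedCategory.Minus C ⥤ DerivedCategory D :=
  projResFunctor ⋙ F.mapHomotopyCategory (.up ℤ) ⋙ Qh

/-- The comparison `LF(X) ⟶ F(L)` attached to a morphism `f : X ⟶ L` in the derived category,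
for a complex `L`. For `f` an identity it is the counit `LF(L) ⟶ F(L)` of the derived functor. -/
noncomputable def leftDerivedTo {X : DerivedCategory.Minus C} {L : HomotopyCategory C (.up ℤ)}
    (f : X.obj ⟶ Qh.obj L) :
    (leftDerived F).obj X ⟶ Qh.obj ((F.mapHomotopyCategory (.up ℤ)).obj L) :=
  Qh.map ((F.mapHomotopyCategory (.up ℤ)).map (projResLift f))

/-- The object `X` placed in degree `0`. -/
noncomputable def minusSingle (X : C) : DerivedCategory.Minus C :=
  ⟨(DerivedCategory.singleFunctor C 0).obj X, 0, inferInstance⟩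

/-- The shift `X[n]` of the object `X` placed in degree `0`. -/
noncomputable def minusSingleShift (X : C) (n : ℕ) : DerivedCategory.Minus C :=
  ⟨((DerivedCategory.singleFunctor C 0).obj X)⟦(n : ℤ)⟧,
    DerivedCategory.TStructure.t.minus.le_shift (n : ℤ) _ (minusSingle X).property⟩

/-- A class in `Ext^n(X, X')`, seen as a morphism `X ⟶ X'[n]` in the derived category. -/
noncomputable def extMinus [HasExt.{v} C] {X X' : C} {n : ℕ} (α : Ext.{v} X X' n) :
    minusSingle X ⟶ minusSingleShift X' n :=
  ObjectProperty.homMk α.hom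

/-- `F` applied termwise to `X` in degree `0` is `F(X)` in degree `0`. -/
noncomputable def singleComparison (X : C) :
    Qh.obj ((F.mapHomotopyCategory (.up ℤ)).obj ((HomotopyCategory.singleFunctor C 0).obj X)) ≅
      (DerivedCategory.singleFunctor D 0).obj (F.obj X) :=
  (quotientCompQhIso D).app _ ≪≫ Q.mapIso ((F.mapCochainComplexSingleFunctor 0).app X)

/-- The composite `LF(X) ⟶ F(X) ⟶ V` of the counit and of `a`, for `X` in degree `0`. -/
noncomputable def leftDerivedToSingle {X : C} {V : D} (a : F.obj X ⟶ V) :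
    (leftDerived F).obj (minusSingle X) ⟶ (DerivedCategory.singleFunctor D 0).obj V :=
  leftDerivedTo F (X := minusSingle X) (L := (HomotopyCategory.singleFunctor C 0).obj X) (𝟙 _) ≫
    (singleComparison F X).hom ≫ (DerivedCategory.singleFunctor D 0).map a

/-- The composite `LF(X[n]) ⟶ F(X)[n] ⟶ V[n]` of the counit and of `a[n]`. -/
noncomputable def leftDerivedToSingleShift {X : C} {V : D} (n : ℕ) (a : F.obj X ⟶ V) :
    (leftDerived F).obj (minusSingleShift X n) ⟶
      ((DerivedCategory.singleFunctor D 0).obj V)⟦(n : ℤ)⟧ :=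
  leftDerivedTo F (X := minusSingleShift X n)
      (L := ((HomotopyCategory.singleFunctor C 0).obj X)⟦(n : ℤ)⟧)
      ((Qh.commShiftIso (n : ℤ)).inv.app _) ≫
    Qh.map (((F.mapHomotopyCategory (.up ℤ)).commShiftIso (n : ℤ)).hom.app _) ≫
    (Qh.commShiftIso (n : ℤ)).hom.app _ ≫
    ((singleComparison F X).hom ≫ (DerivedCategory.singleFunctor D 0).map a)⟦(n : ℤ)⟧'

end Derived

/-! ### Tensor products over a noncommutative ring -/

section Tensor

variable {R S T : Type u} [Ring R] [Ring S] [Ring T]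

/-- The submodule of `X ⊗_ℤ M` spanned by the elements `(j t • x) ⊗ m - x ⊗ (t • m)`.
Here `X` is an `R`-module, which is an `S`-module through `i`, and `t : T` acts on `X` through
`j t : R`. -/
noncomputable def balancedRelations (i : S →+* R) (j : T → R) (M : ModuleCat.{u} T)
    (X : ModuleCat.{u} R) : Submodule S ((ModuleCat.restrictScalars i).obj X ⊗[ℤ] M) :=
  Submodule.span S {z | ∃ (x : X) (t : T) (m : M),
    z = (show (ModuleCat.restrictScalars i).obj X from j t • x) ⊗ₜ[ℤ] m -
      (show (ModuleCat.restrictScalars i).obj X from x) ⊗ₜ[ℤ] (t • m)}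

/-- The functor sending `X` to the `S`-module `(X ⊗_ℤ M) / ((j t • x) ⊗ m - x ⊗ (t • m))`. -/
noncomputable def balancedTensor (i : S →+* R) (j : T → R) (M : ModuleCat.{u} T) :
    ModuleCat.{u} R ⥤ ModuleCat.{u} S where
  obj X := ModuleCat.of S
    (((ModuleCat.restrictScalars i).obj X ⊗[ℤ] M) ⧸ balancedRelations i j M X)
  map {X X'} f := ModuleCat.ofHom <|
    Submodule.mapQ (balancedRelations i j M X) (balancedRelations i j M X')
      (TensorProduct.AlgebraTensorModule.map ((ModuleCat.restrictScalars i).map f).hom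
        (LinearMap.id : M →ₗ[ℤ] M)) (by
      refine Submodule.span_le.2 ?_
      rintro _ ⟨x, t, m, rfl⟩
      refine Submodule.subset_span ⟨f x, t, m, ?_⟩
      rw [map_sub]
      erw [TensorProduct.AlgebraTensorModule.map_tmul, TensorProduct.AlgebraTensorModule.map_tmul]
      erw [← map_smul f.hom (j t) x]
      rfl)
  map_id X := by
    ext : 1
    refine LinearMap.ext fun z => ?_
    obtain ⟨z, rfl⟩ := Submodule.mkQ_surjective _ z
    induction z using TensorProduct.induction_on with
    | zero => simp
    | add a b ha hb => rw [map_add, map_add, ha, hb, map_add]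
    | tmul a b => rfl
  map_comp f g := by
    ext : 1
    refine LinearMap.ext fun z => ?_
    obtain ⟨z, rfl⟩ := Submodule.mkQ_surjective _ z
    induction z using TensorProduct.induction_on with
    | zero => simp
    | add a b ha hb => rw [map_add, map_add, ha, hb, map_add]
    | tmul a b => rfl

/-- The class of the pure tensor `x ⊗ m`. -/
noncomputable def balancedTmul (i : S →+* R) (j : T → R) {M : ModuleCat.{u} T}
    {X : ModuleCat.{u} R} (x : X) (m : M) : (balancedTensor i j M).obj X :=
  Submodule.Quotient.mk ((show (ModuleCat.restrictScalars i).obj X from x) ⊗ₜ[ℤ] m)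

/-- Additive maps out of the tensor product are determined by their values on pure tensors. -/
theorem balancedTensor_ext {i : S →+* R} {j : T → R} {M : ModuleCat.{u} T}
    {X : ModuleCat.{u} R} {W : Type u} [AddCommGroup W]
    {φ ψ : (balancedTensor i j M).obj X →+ W}
    (h : ∀ x m, φ (balancedTmul i j x m) = ψ (balancedTmul i j x m)) : φ = ψ := by
  have key : φ.comp (Submodule.mkQ (balancedRelations i j M X)).toAddMonoidHom =
      ψ.comp (Submodule.mkQ (balancedRelations i j M X)).toAddMonoidHom := by
    refine DFunLike.ext _ _ fun z => ?_
    induction z using TensorProduct.induction_on with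
    | zero => rw [map_zero, map_zero]
    | add a b ha hb => rw [map_add, map_add, ha, hb]
    | tmul a b => exact h a b
  refine DFunLike.ext _ _ fun z => ?_
  obtain ⟨z, rfl⟩ := Submodule.mkQ_surjective _ z
  exact DFunLike.congr_fun key z

theorem balancedTmul_smul (i : S →+* R) (j : T → R) {M : ModuleCat.{u} T}
    {X : ModuleCat.{u} R} (x : X) (t : T) (m : M) :
    balancedTmul i j (j t • x) m = balancedTmul i j x (t • m) :=
  (Submodule.Quotient.eq _).2 (Submodule.subset_span ⟨x, t, m, rfl⟩)

theorem balancedTmul_add (i : S →+* R) (j : T → R) {M : ModuleCat.{u} T}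
    {X : ModuleCat.{u} R} (x : X) (m m' : M) :
    balancedTmul i j x (m + m') = balancedTmul i j x m + balancedTmul i j x m' :=
  congrArg (Submodule.mkQ (balancedRelations i j M X)) (TensorProduct.tmul_add _ _ _)

instance (i : S →+* R) (j : T → R) (M : ModuleCat.{u} T) : (balancedTensor i j M).Additive where
  map_add {X X' f g} := by
    ext : 1
    refine LinearMap.toAddMonoidHom_injective (balancedTensor_ext fun x m => ?_)
    exact congrArg (Submodule.mkQ (balancedRelations i j M X')) (TensorProduct.add_tmul _ _ _)

/-- A balanced pairing `μ`, together with an element `o` of `X` and a map `g` inducing an inverse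
`v ↦ o ⊗ g v`, identifies the tensor product with `V`; explicitly `x ⊗ m ↦ μ x m`. -/
noncomputable def balancedTensorIso (i : S →+* R) (j : T → R) (M : ModuleCat.{u} T)
    (X : ModuleCat.{u} R) (V : ModuleCat.{u} S)
    (μ : (ModuleCat.restrictScalars i).obj X →ₗ[S] M →ₗ[ℤ] V)
    (hμ : ∀ (x : X) (t : T) (m : M), μ (j t • x : X) m = μ x (t • m))
    (o : X) (g : V →+ M) (hg : ∀ v, μ o (g v) = v)
    (ho : ∀ (x : X) (m : M), ∃ t : T, j t • o = x ∧ t • m = g (μ x m)) :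
    (balancedTensor i j M).obj X ≅ V :=
  LinearEquiv.toModuleIso
    { Submodule.liftQ (balancedRelations i j M X) (TensorProduct.AlgebraTensorModule.lift μ) (by
        refine Submodule.span_le.2 ?_
        rintro _ ⟨x, t, m, rfl⟩
        refine LinearMap.mem_ker.2 ?_
        rw [map_sub]
        exact sub_eq_zero.2 (hμ x t m)) with
      invFun := fun v => balancedTmul i j o (g v)
      right_inv := hg
      left_inv := by
        let L : (balancedTensor i j M).obj X →+ V :=
          (Submodule.liftQ (balancedRelations i j M X) (TensorProduct.AlgebraTensorModule.lift μ) (by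
            refine Submodule.span_le.2 ?_
            rintro _ ⟨x, t, m, rfl⟩
            refine LinearMap.mem_ker.2 ?_
            rw [map_sub]
            exact sub_eq_zero.2 (hμ x t m))).toAddMonoidHom
        let B : M →+ (balancedTensor i j M).obj X :=
          AddMonoidHom.mk' (balancedTmul i j o) (balancedTmul_add i j o)
        have : (B.comp g).comp L = AddMonoidHom.id _ := balancedTensor_ext fun x m => by
          obtain ⟨t, rfl, h⟩ := ho x m
          refine Eq.trans ?_ (balancedTmul_smul i j o t m).symm
          exact congrArg (balancedTmul i j o) h.symm
        exact DFunLike.congr_fun this }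

end Tensor

/-! ### Bimodules and twists -/

section Bimodules
open MulOpposite

variable (k : Type v) {E : Type u} [Field k] [Ring E] [Algebra k E]

variable (E) in
/-- The category of `E`-`E`-bimodules on which `k` acts centrally, as `E ⊗_k E^op`-modules:
`a ⊗ b` acts as `x ↦ a x b`. -/
abbrev Bimod : Type (u + 1) := ModuleCat.{u} (E ⊗[k] Eᵐᵒᵖ)

variable (E) in
/-- The bimodule `E`. -/
noncomputable def regularBimod : Bimod k E :=
  letI : Module (E ⊗[k] Eᵐᵒᵖ) E := TensorProduct.Algebra.module
  ModuleCat.of (E ⊗[k] Eᵐᵒᵖ) E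

variable {k}

/-- The twisted bimodule with underlying space `E` and actions `a · x · b = σ(a) x τ(b)`. For `τ`
the identity it is `_σE`, and for `σ` the identity it is `E_τ`. -/
noncomputable def twistedBimod (σ τ : E ≃ₐ[k] E) : Bimod k E :=
  (ModuleCat.restrictScalars
    (Algebra.TensorProduct.map σ.toAlgHom (AlgEquiv.op τ).toAlgHom).toRingHom).obj
    (regularBimod k E)

/-- The twisted left module `_σM`, with action `a · m = σ(a) m`. -/
noncomputable def twistLeft (σ : E ≃ₐ[k] E) (M : ModuleCat.{u} E) : ModuleCat.{u} E :=
  (ModuleCat.restrictScalars σ.toAlgHom.toRingHom).obj M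

/-- The twisted right module `N_τ`, with action `n · b = n τ(b)`. -/
noncomputable def twistRight (τ : E ≃ₐ[k] E) (N : ModuleCat.{u} Eᵐᵒᵖ) : ModuleCat.{u} Eᵐᵒᵖ :=
  (ModuleCat.restrictScalars (AlgEquiv.op τ).toAlgHom.toRingHom).obj N

variable (k) in
/-- The functor `X ↦ X ⊗_E M` from bimodules to left `E`-modules, for a left `E`-module `M`:
the relations are `x e ⊗ m = x ⊗ e m`. -/
noncomputable def tensorLeftModule (M : ModuleCat.{u} E) : Bimod k E ⥤ ModuleCat.{u} E :=
  balancedTensor (Algebra.TensorProduct.includeLeftRingHom (R := k) (A := E) (B := Eᵐᵒᵖ))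
    (fun e : E => (1 : E) ⊗ₜ[k] op e) M

variable (k) in
/-- The functor `X ↦ N ⊗_E X` from bimodules to right `E`-modules, for a right `E`-module `N`.
The two factors are written in the reverse order, as a quotient of `X ⊗_ℤ N`: the relations
are `e x ⊗ n = x ⊗ n e`. -/
noncomputable def tensorRightModule (N : ModuleCat.{u} Eᵐᵒᵖ) : Bimod k E ⥤ ModuleCat.{u} Eᵐᵒᵖ :=
  balancedTensor
    (Algebra.TensorProduct.includeRight (R := k) (A := E) (B := Eᵐᵒᵖ)).toRingHom
    (fun e : Eᵐᵒᵖ => unop e ⊗ₜ[k] (1 : Eᵐᵒᵖ)) N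

instance (M : ModuleCat.{u} E) : (tensorLeftModule k M).Additive :=
  inferInstanceAs (balancedTensor _ _ M).Additive

instance (N : ModuleCat.{u} Eᵐᵒᵖ) : (tensorRightModule k N).Additive :=
  inferInstanceAs (balancedTensor _ _ N).Additive

/-- The action of `a ⊗ b` on the bimodule `E`. -/
theorem regularBimod_smul (a : E) (b : Eᵐᵒᵖ) (x : E) :
    ((a ⊗ₜ[k] b) • (show regularBimod k E from x) : regularBimod k E) =
      (a * x * unop b : E) :=
  (mul_assoc a x (unop b)).symm

/-- The action of `a ⊗ b` on the twisted bimodule. -/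
theorem twistedBimod_smul (σ τ : E ≃ₐ[k] E) (a : E) (b : Eᵐᵒᵖ) (x : E) :
    ((a ⊗ₜ[k] b) • (show twistedBimod σ τ from x) : twistedBimod σ τ) =
      (σ a * x * τ (unop b) : E) :=
  (mul_assoc (σ a) x (τ (unop b))).symm

/-- The action of `E` on `M` as a biadditive map. -/
noncomputable def smulHom (M : ModuleCat.{u} E) : E →+ M →ₗ[ℤ] M :=
  AddMonoidHom.mk' (fun e => (DistribSMul.toAddMonoidHom M e).toIntLinearMap)
    (fun a b => LinearMap.ext fun m => add_smul a b m)

/-- `E ⊗_E M ≅ M`, `x ⊗ m ↦ x m`. -/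
noncomputable def regularTensorLeft (M : ModuleCat.{u} E) :
    (tensorLeftModule k M).obj (regularBimod k E) ≅ M :=
  balancedTensorIso _ _ M _ _
    { smulHom M with
      map_smul' := fun a x => LinearMap.ext fun m => by
        have h := regularBimod_smul (k := k) a 1 (show E from x)
        rw [unop_one, mul_one] at h
        exact (congrArg (fun y : E => y • m) h).trans (mul_smul a (show E from x) m) }
    (fun x t m => by
      have h := regularBimod_smul (k := k) 1 (op t) (show E from x)
      rw [unop_op, one_mul] at h
      exact (congrArg (fun y : E => y • m) h).trans (mul_smul (show E from x) t m))
    (1 : E) (AddMonoidHom.id M) (fun m => one_smul E m)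
    (fun x m => ⟨(x : E), by
      have h := regularBimod_smul (k := k) 1 (op (show E from x)) 1
      rw [unop_op, one_mul, one_mul] at h
      exact h, rfl⟩)

/-- `_σE ⊗_E M ≅ _σM`, `x ⊗ m ↦ x m`. -/
noncomputable def twistedTensorLeft (σ : E ≃ₐ[k] E) (M : ModuleCat.{u} E) :
    (tensorLeftModule k M).obj (twistedBimod σ AlgEquiv.refl) ≅ twistLeft σ M :=
  balancedTensorIso _ _ M _ _
    { smulHom M with
      map_smul' := fun a x => LinearMap.ext fun m => by
        have h := twistedBimod_smul σ AlgEquiv.refl a 1 (show E from x)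
        rw [unop_one, map_one, mul_one] at h
        exact (congrArg (fun y : E => y • m) h).trans (mul_smul (σ a) (show E from x) m) }
    (fun x t m => by
      have h := twistedBimod_smul σ AlgEquiv.refl 1 (op t) (show E from x)
      rw [unop_op, map_one, one_mul] at h
      exact (congrArg (fun y : E => y • m) h).trans (mul_smul (show E from x) t m))
    (1 : E) (AddMonoidHom.id M) (fun m => one_smul E (show M from m))
    (fun x m => ⟨(x : E), by
      have h := twistedBimod_smul σ AlgEquiv.refl 1 (op (show E from x)) 1
      rw [map_one, one_mul, one_mul] at h
      exact h, rfl⟩)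

/-- The right action of `E` on `N` as a biadditive map `(x, n) ↦ n x`. -/
noncomputable def smulHomOp (N : ModuleCat.{u} Eᵐᵒᵖ) : E →+ N →ₗ[ℤ] N :=
  AddMonoidHom.mk' (fun e => (DistribSMul.toAddMonoidHom N (op e)).toIntLinearMap)
    (fun a b => LinearMap.ext fun m => by
      exact (congrArg (· • m) (op_add a b)).trans (add_smul (op a) (op b) m))

/-- `N ⊗_E E ≅ N`, `n ⊗ x ↦ n x`. -/
noncomputable def regularTensorRight (N : ModuleCat.{u} Eᵐᵒᵖ) :
    (tensorRightModule k N).obj (regularBimod k E) ≅ N :=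
  balancedTensorIso _ _ N _ _
    { smulHomOp N with
      map_smul' := fun b x => LinearMap.ext fun m => by
        have h := regularBimod_smul (k := k) 1 b (show E from x)
        rw [one_mul] at h
        exact (congrArg (fun y : E => op y • m) h).trans (mul_smul b (op (show E from x)) m) }
    (fun x t m => by
      have h := regularBimod_smul (k := k) (unop t) 1 (show E from x)
      rw [unop_one, mul_one] at h
      exact (congrArg (fun y : E => op y • m) h).trans (mul_smul (op (show E from x)) t m))
    (1 : E) (AddMonoidHom.id N) (fun m => one_smul Eᵐᵒᵖ m)
    (fun x m => ⟨op (x : E), by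
      have h := regularBimod_smul (k := k) (show E from x) 1 1
      rw [unop_one, mul_one, mul_one] at h
      exact h, rfl⟩)

/-- `N ⊗_E E_τ ≅ N_τ`, `n ⊗ x ↦ n x`. -/
noncomputable def twistedTensorRight (τ : E ≃ₐ[k] E) (N : ModuleCat.{u} Eᵐᵒᵖ) :
    (tensorRightModule k N).obj (twistedBimod AlgEquiv.refl τ) ≅ twistRight τ N :=
  balancedTensorIso _ _ N _ _
    { smulHomOp N with
      map_smul' := fun b x => LinearMap.ext fun m => by
        have h := twistedBimod_smul AlgEquiv.refl τ 1 b (show E from x)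
        rw [map_one, one_mul] at h
        exact (congrArg (fun y : E => op y • m) h).trans
          (mul_smul (op (τ (unop b))) (op (show E from x)) m) }
    (fun x t m => by
      have h := twistedBimod_smul AlgEquiv.refl τ (unop t) 1 (show E from x)
      rw [unop_one, map_one, mul_one] at h
      exact (congrArg (fun y : E => op y • m) h).trans (mul_smul (op (show E from x)) t m))
    (1 : E) (AddMonoidHom.id N) (fun m => one_smul Eᵐᵒᵖ (show N from m))
    (fun x m => ⟨op (x : E), by
      have h := twistedBimod_smul AlgEquiv.refl τ (x : E) 1 1
      rw [unop_one, map_one, mul_one, mul_one] at h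
      exact h, rfl⟩)

/-- The isomorphism of bimodules `_σE ≅ E_{σ⁻¹}`, `x ↦ σ⁻¹(x)`. -/
noncomputable def twistIso (σ : E ≃ₐ[k] E) :
    twistedBimod σ AlgEquiv.refl ≅ twistedBimod AlgEquiv.refl σ.symm :=
  LinearEquiv.toModuleIso (X₁ := twistedBimod σ AlgEquiv.refl)
    (X₂ := twistedBimod AlgEquiv.refl σ.symm) <|
    show twistedBimod σ AlgEquiv.refl ≃ₗ[E ⊗[k] Eᵐᵒᵖ] twistedBimod AlgEquiv.refl σ.symm from
    { σ.symm.toRingEquiv.toAddEquiv with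
      map_smul' := fun c x => by
        induction c using TensorProduct.induction_on with
        | zero =>
          exact (congrArg σ.symm (zero_smul (E ⊗[k] Eᵐᵒᵖ) x)).trans
            ((map_zero σ.symm).trans
              (zero_smul (E ⊗[k] Eᵐᵒᵖ)
                (show twistedBimod AlgEquiv.refl σ.symm from σ.symm (show E from x))).symm)
        | add a b ha hb =>
          exact (congrArg σ.symm (add_smul a b x)).trans
            ((map_add σ.symm (show E from a • x) (show E from b • x)).trans
              ((congrArg₂ (fun y z : E => y + z) ha hb).trans
                (add_smul a b
                  (show twistedBimod AlgEquiv.refl σ.symm from σ.symm (show E from x))).symm))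
        | tmul a b =>
          refine (congrArg σ.symm (twistedBimod_smul σ AlgEquiv.refl a b (show E from x))).trans
            (Eq.trans ?_ (twistedBimod_smul AlgEquiv.refl σ.symm a b
              (σ.symm (show E from x))).symm)
          have key (y : E) : σ.symm (σ a * y * MulOpposite.unop b) =
              a * σ.symm y * σ.symm (MulOpposite.unop b) := by simp
          exact key x }

end Bimodules

/-! ### Stable isomorphisms, Heller translates, perfect complexes -/

section Stable

variable {R : Type u} [Ring R]

/-- `f` factors through a finitely generated projective module, i.e. it vanishes in the stable
module category. -/
def FactorsThroughProjective {K L : ModuleCat.{u} R} (f : K ⟶ L) : Prop :=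
  ∃ (P : ModuleCat.{u} R) (a : K ⟶ P) (b : P ⟶ L),
    Module.Projective R P ∧ Module.Finite R P ∧ a ≫ b = f

/-- `f` is an isomorphism in the stable module category. -/
def IsStableIso {K L : ModuleCat.{u} R} (f : K ⟶ L) : Prop :=
  ∃ g : L ⟶ K, FactorsThroughProjective (f ≫ g - 𝟙 K) ∧ FactorsThroughProjective (g ≫ f - 𝟙 L)

/-- `π : P ⟶ M` is a projective cover: `P` is finitely generated projective, `π` is surjective and
its kernel is superfluous in `P`. -/
structure IsProjectiveCover {P M : ModuleCat.{u} R} (π : P ⟶ M) : Prop where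
  projective : Module.Projective R P
  finite : Module.Finite R P
  surjective : Function.Surjective π
  superfluous : ∀ U : Submodule R P, U ⊔ LinearMap.ker π.hom = ⊤ → U = ⊤

/-- `IsHellerClass M n K ξ` means that `K` is an `n`-th Heller translate `Ω^n(M)`, obtained by
taking `n` times the kernel of a projective cover, and that `ξ ∈ Ext^n(M, Ω^n(M))` is the class of
the resulting exact sequence `0 → Ω^n(M) → P_{n-1} → ⋯ → P_0 → M → 0`, i.e. the Yoneda product of
the classes of the short exact sequences `0 → Ω^{i+1}(M) → P_i → Ω^i(M) → 0`. -/
inductive IsHellerClass (M : ModuleCat.{u} R) :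
    ∀ (n : ℕ) (K : ModuleCat.{u} R), Ext.{u} M K n → Prop
  | zero : IsHellerClass M 0 M (Ext.mk₀ (𝟙 M))
  | succ {n : ℕ} (S : ShortComplex (ModuleCat.{u} R)) (hS : S.ShortExact)
      (hg : IsProjectiveCover S.g) (ξ : Ext.{u} M S.X₃ n) (hξ : IsHellerClass M n S.X₃ ξ) :
      IsHellerClass M (n + 1) S.X₁ (ξ.comp hS.extClass rfl)

variable [HasDerivedCategory.{w} (ModuleCat.{u} R)]

/-- A perfect object of the derived category: one which is isomorphic to a bounded complex of
finitely generated projective modules. -/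
def IsPerfect (X : DerivedCategory (ModuleCat.{u} R)) : Prop :=
  ∃ K : CochainComplex (ModuleCat.{u} R) ℤ,
    (∃ a : ℤ, K.IsStrictlyGE a) ∧ (∃ b : ℤ, K.IsStrictlyLE b) ∧
    (∀ i, Module.Projective R (K.X i) ∧ Module.Finite R (K.X i)) ∧
    Nonempty (DerivedCategory.Q.obj K ≅ X)

end Stable

/-! ### Strong periodicity -/

section Periodic

variable {A R : Type u} [Ring A] [Ring R] [HasDerivedCategory.{w} (ModuleCat.{u} A)]
  [HasDerivedCategory.{w'} (ModuleCat.{u} R)]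
  (F : ModuleCat.{u} A ⥤ ModuleCat.{u} R) [F.Additive]

/-- Let `α ∈ Ext^n(X, X')`, and let `F(X) ≅ V` and `F(X') ≅ V'`. The class `β ∈ Ext^n(V, V')` is
the image of `α` under the left derived functor of `F`: the square with horizontal maps
`LF(α) : LF(X) ⟶ LF(X'[n])` and `β : V ⟶ V'[n]`, whose vertical maps come from the counit
`LF ⟶ F`, commutes. (When `X` is acyclic for `F`, so that `LF(X) ⟶ F(X)` is invertible, there
is exactly one such `β`.) -/
def IsDerivedImage {X X' : ModuleCat.{u} A} {V V' : ModuleCat.{u} R} (a : F.obj X ≅ V)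
    (b : F.obj X' ≅ V') {n : ℕ} (α : Ext.{u} X X' n) (β : Ext.{u} V V' n) : Prop :=
  (leftDerived F).map (extMinus α) ≫ leftDerivedToSingleShift F n b.hom =
    leftDerivedToSingle F a.hom ≫ β.hom

/-- The image `β ∈ Ext^n(V, V')` of `α` under the left derived functor of `F` induces an
isomorphism `Ω^n(V) ≅ V'` in the stable module category. A morphism `f : Ω^n(V) ⟶ V'` is induced
by `β` when `β` is the pushforward along `f` of the class `ξ ∈ Ext^n(V, Ω^n(V))` of the
truncated minimal projective resolution of `V`. -/
def InducesStableIso {X X' : ModuleCat.{u} A} {V V' : ModuleCat.{u} R} (a : F.obj X ≅ V)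
    (b : F.obj X' ≅ V') {n : ℕ} (α : Ext.{u} X X' n) : Prop :=
  ∃ (K : ModuleCat.{u} R) (ξ : Ext.{u} V K n) (f : K ⟶ V'), IsHellerClass V n K ξ ∧
    IsDerivedImage F a b α (ξ.comp (Ext.mk₀ f) (add_zero n)) ∧ IsStableIso f

end Periodic

section Strong

/-- A self-injective ring: the regular left module and the regular right module are injective.
For a finite-dimensional algebra each of the two conditions implies the other one. -/
def IsSelfInjective (E : Type u) [Ring E] : Prop :=
  Module.Injective E E ∧ Module.Injective Eᵐᵒᵖ E

variable {k : Type v} {E : Type u} [Field k] [Ring E] [Algebra k E]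
  [HasDerivedCategory.{w} (Bimod k E)]

/-- The derived tensor product `Y ⊗^L_E M`, where `M` is a left `E`-module. -/
noncomputable def derivedTensorLeftModule [HasDerivedCategory.{w₁} (ModuleCat.{u} E)]
    (Y : DerivedCategory.Minus (Bimod k E)) (M : ModuleCat.{u} E) :
    DerivedCategory (ModuleCat.{u} E) :=
  (leftDerived (tensorLeftModule k M)).obj Y

/-- The derived tensor product `N ⊗^L_E Y`, where `N` is a right `E`-module. -/
noncomputable def derivedTensorRightModule [HasDerivedCategory.{w₁} (ModuleCat.{u} Eᵐᵒᵖ)]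
    (N : ModuleCat.{u} Eᵐᵒᵖ) (Y : DerivedCategory.Minus (Bimod k E)) :
    DerivedCategory (ModuleCat.{u} Eᵐᵒᵖ) :=
  (leftDerived (tensorRightModule k N)).obj Y

/-- The left `E`-module `M` is strongly `σ`-periodic of period `n` relative to
`α ∈ Ext^n(E, _σE)`: the class `α ⊗^L_E M ∈ Ext^n(M, _σM)` induces an isomorphism
`Ω^n(M) ≅ _σM` in the stable category of `E`-modules. -/
def IsStronglyPeriodic [HasDerivedCategory.{w₁} (ModuleCat.{u} E)] (σ : E ≃ₐ[k] E) (n : ℕ)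
    (α : Ext.{u} (regularBimod k E) (twistedBimod σ AlgEquiv.refl) n) (M : ModuleCat.{u} E) :
    Prop :=
  InducesStableIso (tensorLeftModule k M) (regularTensorLeft M) (twistedTensorLeft σ M) α

/-- The right `E`-module `N` is strongly `τ`-periodic of period `n` relative to
`α ∈ Ext^n(E, E_τ)`: the class `N ⊗^L_E α ∈ Ext^n(N, N_τ)` induces an isomorphism
`Ω^n(N) ≅ N_τ` in the stable category of right `E`-modules. -/
def IsStronglyPeriodicRight [HasDerivedCategory.{w₁} (ModuleCat.{u} Eᵐᵒᵖ)] (τ : E ≃ₐ[k] E) (n : ℕ)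
    (α : Ext.{u} (regularBimod k E) (twistedBimod AlgEquiv.refl τ) n)
    (N : ModuleCat.{u} Eᵐᵒᵖ) : Prop :=
  InducesStableIso (tensorRightModule k N) (regularTensorRight N) (twistedTensorRight τ N) α

end Strong

end StrongPeriodicity

/-! The perfect complexes form a triangulated subcategory of the derived category. Write `(perfect
R).trW` for the class of morphisms whose cone is perfect. It satisfies two-out-of-three, and
everything is measured by it.

Deriving the tensor product carries the given triangle to one in which `Y ⊗ᴸ M` is the cocone of
`LF(α)` (`leftDerived_distinguished`), so perfectness of `Y ⊗ᴸ M` means that `LF(α)` lies in `trW`.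
Although `E` and `_σE` are not projective bimodules, they are projective as right modules, and the
group underlying `X ⊗_E M` sees only the right structure of `X`. Hence the counits `LF(E) ⟶ M` and
`LF(_σE[n]) ⟶ _σM[n]` are invertible (`isIso_leftDerivedTo`) and `LF(α)` is identified with a class
`β : M ⟶ _σM[n]`.

Dimension shifting factors `β` as the Heller class `ξ : M ⟶ Ω^n(M)[n]` followed by `f[n]`, for some
`f : Ω^n(M) ⟶ _σM`. The class `ξ` is a product of connecting maps whose cones are shifts of finitely
generated projectives, so `ξ` lies in `trW`. By cancellation `β` lies in `trW` exactly when `f`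
does.

It remains to compare `trW` with stable isomorphisms (`isStableIso_iff_trW`); this is where
self-injectivity enters. Adding a projective to the source makes `f` an epimorphism, whose cone is
its kernel up to shift. The map `f` is a stable isomorphism if and only if this kernel is
projective, and a finitely generated module that is perfect as a complex is projective
(`fgProj_of_isPerfect`). Right modules are handled by the same argument with the two sides
exchanged. -/

/-! ### Morphisms with cone in a triangulated subcategory -/

section Triangulated
open Pretriangulated

variable {C : Type*} [Category* C] [HasZeroObject C] [HasShift C ℤ] [Preadditive C]
  [∀ n : ℤ, (shiftFunctor C n).Additive] [Pretriangulated C] [IsTriangulated C]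

/-- If `f` and `f ≫ g` have their cones in a triangulated subcategory, so has `g`. -/
theorem CategoryTheory.ObjectProperty.trW_of_precomp (P : ObjectProperty C) [P.IsTriangulated]
    {X Y Z : C} (f : X ⟶ Y) (g : Y ⟶ Z) (hf : P.trW f) (hfg : P.trW (f ≫ g)) : P.trW g := by
  -- The octahedron places the cone of `g` only in the isomorphism closure of `P`.
  rw [← P.trW_isoClosure]
  obtain ⟨Z₁₂, v₁₂, w₁₂, H₁₂, h₁₂⟩ := hf
  obtain ⟨Z₁₃, v₁₃, w₁₃, H₁₃, h₁₃⟩ := hfg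
  obtain ⟨Z₂₃, v₂₃, w₂₃, H₂₃⟩ := distinguished_cocone_triangle g
  exact ⟨_, _, _, H₂₃, P.ext_of_isTriangulatedClosed₃' _
    (Triangulated.someOctahedron rfl H₁₂ H₂₃ H₁₃).mem h₁₂ h₁₃⟩

theorem CategoryTheory.ObjectProperty.trW_precomp_iff (P : ObjectProperty C) [P.IsTriangulated]
    {X Y Z : C} (f : X ⟶ Y) (g : Y ⟶ Z) (hf : P.trW f) : P.trW (f ≫ g) ↔ P.trW g :=
  ⟨P.trW_of_precomp f g hf, fun hg => P.trW.comp_mem f g hf hg⟩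

end Triangulated

namespace StrongPeriodicity

/-! ### Perfect complexes -/

section Perfect

open DerivedCategory CochainComplex Pretriangulated

variable {R : Type u} [Ring R]

/-- The finitely generated projective modules. -/
def FGProj (P : ModuleCat.{u} R) : Prop := Module.Projective R P ∧ Module.Finite R P

theorem FGProj.projective {P : ModuleCat.{u} R} (h : FGProj P) : Projective P :=
  (IsProjective.iff_projective P).1 h.1

theorem FGProj.of_iso {P P' : ModuleCat.{u} R} (h : FGProj P) (e : P ≅ P') : FGProj P' := by
  obtain ⟨h₁, h₂⟩ := h
  exact ⟨Module.Projective.of_equiv e.toLinearEquiv, Module.Finite.equiv e.toLinearEquiv⟩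

theorem FGProj.of_isZero {P : ModuleCat.{u} R} (h : IsZero P) : FGProj P := by
  have := ModuleCat.subsingleton_of_isZero h
  exact ⟨Module.Projective.of_free, inferInstance⟩

theorem FGProj.biprod {P P' : ModuleCat.{u} R} (h : FGProj P) (h' : FGProj P') :
    FGProj (P ⊞ P') := by
  obtain ⟨h₁, h₂⟩ := h
  obtain ⟨h₁', h₂'⟩ := h'
  refine FGProj.of_iso ?_ (ModuleCat.biprodIsoProd P P').symm
  exact ⟨inferInstanceAs (Module.Projective R (P × P')), inferInstanceAs (Module.Finite R (P × P'))⟩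

variable [HasDerivedCategory.{w} (ModuleCat.{u} R)]

variable (R) in
/-- The perfect objects of the derived category. -/
def perfect : ObjectProperty (DerivedCategory (ModuleCat.{u} R)) := fun X => IsPerfect X

theorem perfect_Q_obj (K : CochainComplex (ModuleCat.{u} R) ℤ) (a b : ℤ) [K.IsStrictlyGE a]
    [K.IsStrictlyLE b] (hK : ∀ i, FGProj (K.X i)) : perfect R (Q.obj K) :=
  ⟨K, ⟨a, inferInstance⟩, ⟨b, inferInstance⟩, hK, ⟨Iso.refl _⟩⟩

instance : (perfect R).IsClosedUnderIsomorphisms where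
  of_iso e := by
    rintro ⟨K, ha, hb, hK, ⟨e'⟩⟩
    exact ⟨K, ha, hb, hK, ⟨e' ≪≫ e⟩⟩

theorem perfect_single {P : ModuleCat.{u} R} (hP : FGProj P) (i : ℤ) :
    perfect R ((DerivedCategory.singleFunctor (ModuleCat.{u} R) i).obj P) := by
  refine perfect_Q_obj ((CochainComplex.singleFunctor (ModuleCat.{u} R) i).obj P) i i ?_
  intro j
  by_cases h : j = i
  · subst h
    exact hP.of_iso (HomologicalComplex.singleObjXSelf _ _ _).symm
  · exact FGProj.of_isZero (HomologicalComplex.isZero_single_obj_X _ _ _ _ h)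

instance : (perfect R).ContainsZero where
  exists_zero := ⟨_, (DerivedCategory.singleFunctor (ModuleCat.{u} R) 0).map_isZero (isZero_zero _),
    perfect_single (FGProj.of_isZero (isZero_zero _)) 0⟩

instance : (perfect R).IsStableUnderShift ℤ where
  isStableUnderShiftBy n :=
    { le_shift := by
        rintro X ⟨K, ⟨a, ha⟩, ⟨b, hb⟩, hK, ⟨e⟩⟩
        have := K.isStrictlyGE_shift a n (a - n) (by lia)
        have := K.isStrictlyLE_shift b n (b - n) (by lia)
        have h := perfect_Q_obj (K⟦n⟧) (a - n) (b - n) (fun i => hK (i + n))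
        exact (perfect R).prop_of_iso ((Q.commShiftIso n).app K ≪≫ (CategoryTheory.shiftFunctor _ n).mapIso e) h }

theorem perfect_mappingCone {K L : CochainComplex (ModuleCat.{u} R) ℤ} (φ : K ⟶ L)
    (a b a' b' : ℤ) [K.IsStrictlyGE a] [K.IsStrictlyLE b] [L.IsStrictlyGE a'] [L.IsStrictlyLE b']
    (hK : ∀ i, FGProj (K.X i)) (hL : ∀ i, FGProj (L.X i)) :
    perfect R (Q.obj (mappingCone φ)) := by
  have e (i : ℤ) : (mappingCone φ).X i ≅ K.X (i + 1) ⊞ L.X i :=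
    HomologicalComplex.homotopyCofiber.XIsoBiprod φ i (i + 1) rfl
  have h0 (i : ℤ) (h₁ : IsZero (K.X (i + 1))) (h₂ : IsZero (L.X i)) :
      IsZero ((mappingCone φ).X i) :=
    (IsZero.of_iso ((biprod_isZero_iff _ _).2 ⟨h₁, h₂⟩) (e i))
  -- The term of the cone in degree `i` is `K.X (i + 1) ⊞ L.X i`, so `K` contributes from degree `a
  -- - 1` on. The upper bound `max b b'` below is not sharp, which is harmless.
  have : (mappingCone φ).IsStrictlyGE (min (a - 1) a') := by
    rw [isStrictlyGE_iff]
    intro i hi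
    exact h0 i (K.isZero_of_isStrictlyGE a _ (by lia)) (L.isZero_of_isStrictlyGE a' _ (by lia))
  have : (mappingCone φ).IsStrictlyLE (max b b') := by
    rw [isStrictlyLE_iff]
    intro i hi
    exact h0 i (K.isZero_of_isStrictlyLE b _ (by lia)) (L.isZero_of_isStrictlyLE b' _ (by lia))
  exact perfect_Q_obj _ (min (a - 1) a') (max b b')
    (fun i => ((hK (i + 1)).biprod (hL i)).of_iso (e i).symm)

/-- Morphisms in the derived category from a bounded above complex of projectives to an
arbitrary complex are represented by maps of complexes. -/
theorem Q_map_surjective (K L : CochainComplex (ModuleCat.{u} R) ℤ) (b : ℤ) [K.IsStrictlyLE b]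
    (hK : ∀ i, FGProj (K.X i)) : Function.Surjective (Q.map : (K ⟶ L) → _) := by
  intro g
  have := fun i => (hK i).projective
  have := isKProjective_of_projective K b
  obtain ⟨ψ, hψ⟩ := (IsKProjective.Qh_map_bijective K
    ((HomotopyCategory.quotient _ _).obj L)).surjective
    ((quotientCompQhIso _).hom.app K ≫ g ≫ (quotientCompQhIso _).inv.app L)
  obtain ⟨φ, rfl⟩ := (HomotopyCategory.quotient _ _).map_surjective ψ
  refine ⟨φ, ?_⟩
  have h := (quotientCompQhIso (ModuleCat.{u} R)).hom.naturality φ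
  dsimp at h
  rw [← cancel_epi ((quotientCompQhIso (ModuleCat.{u} R)).hom.app K), ← h]
  erw [hψ]
  simp

/-- A morphism between perfect objects is represented by a map of bounded complexes of projectives,
so the third vertex of a triangle on it is the mapping cone of that map. -/
instance : (perfect R).IsTriangulatedClosed₃ := .mk' (by
  rintro T hT ⟨K, ⟨a, ha⟩, ⟨b, hb⟩, hK, ⟨e⟩⟩ ⟨L, ⟨a', ha'⟩, ⟨b', hb'⟩, hL, ⟨e'⟩⟩
  obtain ⟨φ, hφ⟩ := Q_map_surjective K L b hK (e.hom ≫ T.mor₁ ≫ e'.inv)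
  obtain ⟨e'', -⟩ := exists_iso_of_arrow_iso _ _ (mappingCone_triangle_distinguished φ) hT
    (Arrow.isoMk e e' (by
      change e.hom ≫ T.mor₁ = Q.map φ ≫ e'.hom
      simp [hφ]))
  exact (perfect R).prop_of_iso (Triangle.π₃.mapIso e'')
    (perfect_mappingCone φ a b a' b' hK hL))

instance : (perfect R).IsTriangulated where
  toIsTriangulatedClosed₂ := .of_isTriangulatedClosed₃

end Perfect

/-! ### Finitely generated modules over a self-injective ring -/

section SelfInjective

open Pretriangulated

variable {R : Type u} [Ring R]

theorem exists_fgProj_epi (L : ModuleCat.{u} R) [Module.Finite R L] :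
    ∃ (P : ModuleCat.{u} R) (p : P ⟶ L), FGProj P ∧ Epi p := by
  obtain ⟨n, f, hf⟩ := Module.Finite.exists_fin' R L
  exact ⟨ModuleCat.of R (Fin n → R), ModuleCat.ofHom f, ⟨inferInstance, inferInstance⟩,
    (ModuleCat.epi_iff_surjective _).2 hf⟩

theorem finite_of_mono [IsNoetherianRing R] {K L : ModuleCat.{u} R} (f : K ⟶ L) [Mono f]
    [Module.Finite R L] : Module.Finite R K :=
  have : IsNoetherian R L := isNoetherian_of_isNoetherianRing_of_finite R L
  Module.Finite.of_injective f.hom ((ModuleCat.mono_iff_injective f).1 inferInstance)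

theorem finite_biprod (K L : ModuleCat.{u} R) [Module.Finite R K] [Module.Finite R L] :
    Module.Finite R (K ⊞ L : ModuleCat.{u} R) :=
  have : Module.Finite R (ModuleCat.of R (K × L)) := inferInstanceAs (Module.Finite R (K × L))
  Module.Finite.equiv (ModuleCat.biprodIsoProd K L).symm.toLinearEquiv

theorem finite_of_epi {K L : ModuleCat.{u} R} (f : K ⟶ L) [Epi f] [Module.Finite R K] :
    Module.Finite R L :=
  Module.Finite.of_surjective f.hom ((ModuleCat.epi_iff_surjective f).1 inferInstance)

theorem FGProj.of_retract {P P' : ModuleCat.{u} R} (h : FGProj P) (r : Retract P' P) :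
    FGProj P' := by
  have := h.2
  have := h.projective
  exact ⟨(IsProjective.iff_projective P').2 r.projective, finite_of_epi r.r⟩

/-- Finitely generated projective modules over a self-injective ring are injective. -/
theorem FGProj.injective (hR : Module.Injective R R) {P : ModuleCat.{u} R} (hP : FGProj P) :
    Injective P := by
  obtain ⟨h₁, h₂⟩ := hP
  obtain ⟨n, f, hf⟩ := Module.Finite.exists_fin' R P
  have : Module.Injective R (Fin n → R) := inferInstance
  have : Injective (ModuleCat.of R (Fin n → R)) :=
    Module.injective_object_of_injective_module R (Fin n → R)
  -- The section exhibits `P` as a retract of the injective module `R^n`.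
  obtain ⟨g, hg⟩ := Module.projective_lifting_property f LinearMap.id hf
  exact Retract.injective
    { i := ModuleCat.ofHom g, r := ModuleCat.ofHom f, retract := by ext x; exact congr($hg x) }

/-- If `K` is a bounded projective model of `Q`, a class of degree `i` is a map from `K` to `L`
placed in degree `-i`, and `K` vanishes there once `-i < a`. The bound `N` does not depend on `L`,
which allows `L` to be replaced by its syzygies later. -/
theorem ext_eq_zero_of_isPerfect [HasDerivedCategory.{w} (ModuleCat.{u} R)] {Q : ModuleCat.{u} R}
    (hQ : perfect R ((DerivedCategory.singleFunctor _ 0).obj Q)) :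
    ∃ N : ℕ, ∀ i ≥ N, ∀ (L : ModuleCat.{u} R) (x : Ext.{u} Q L i), x = 0 := by
  obtain ⟨K, ⟨a, ha⟩, ⟨b, hb⟩, hK, ⟨e⟩⟩ := hQ
  refine ⟨(-a).toNat + 1, fun i hi L x => ?_⟩
  apply Ext.homEquiv.injective
  let e' := ((DerivedCategory.singleFunctors (ModuleCat.{u} R)).shiftIso (i : ℤ) (-i) 0
    (by lia)).app L
  rw [← cancel_mono e'.hom, ← cancel_epi e.hom]
  obtain ⟨φ, hφ⟩ := Q_map_surjective K ((CochainComplex.singleFunctor _ (-i : ℤ)).obj L) b hK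
    (e.hom ≫ Ext.homEquiv x ≫ e'.hom)
  have : φ = 0 := HomologicalComplex.to_single_hom_ext
    ((K.isZero_of_isStrictlyGE a _ (by lia)).eq_of_src _ _)
  change e.hom ≫ Ext.homEquiv x ≫ e'.hom = e.hom ≫ Ext.hom 0 ≫ e'.hom
  erw [← hφ]
  rw [this, Ext.zero_hom, Functor.map_zero, zero_comp, comp_zero]
  rfl

/-- Over a Noetherian self-injective ring, a finitely generated module which is perfect as a
complex is projective. -/
theorem fgProj_of_isPerfect [IsNoetherianRing R] (hR : Module.Injective R R)
    [HasDerivedCategory.{w} (ModuleCat.{u} R)] {Q : ModuleCat.{u} R} [Module.Finite R Q]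
    (hQ : perfect R ((DerivedCategory.singleFunctor _ 0).obj Q)) : FGProj Q := by
  obtain ⟨N, hN⟩ := ext_eq_zero_of_isPerfect hQ
  -- Vanishing propagates downwards from degree `N` to degree `1`; `d` measures the distance to `N`.
  -- For `0 → L' → P → L → 0`, with `P` projective and hence injective, `Ext^(i+1)(Q, L)` embeds in
  -- `Ext^(i+2)(Q, L')`. The Noetherian hypothesis keeps `L'` finitely generated.
  have key : ∀ (d i : ℕ), N ≤ i + 1 + d → ∀ (L : ModuleCat.{u} R), Module.Finite R L →
      ∀ x : Ext.{u} Q L (i + 1), x = 0 := by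
    intro d
    induction d with
    | zero => intro i hi L _ x; exact hN _ hi L x
    | succ d ih =>
      intro i hi L _ x
      obtain ⟨P, p, hP, _⟩ := exists_fgProj_epi L
      have := hP.injective hR
      have := hP.2
      have hS : (ShortComplex.mk _ _ (kernel.condition p)).ShortExact :=
        { exact := ShortComplex.exact_kernel p }
      obtain ⟨y, rfl⟩ := Ext.covariant_sequence_exact₃ Q hS x rfl
        (ih (i + 1) (by lia) _ (finite_of_mono (kernel.ι p)) _)
      rw [y.eq_zero_of_injective, Ext.zero_comp]
  obtain ⟨P, p, hP, _⟩ := exists_fgProj_epi Q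
  have := hP.2
  have hS : (ShortComplex.mk _ _ (kernel.condition p)).ShortExact :=
    { exact := ShortComplex.exact_kernel p }
  -- The obstruction to lifting the identity of `Q` through `p` lies in `Ext^1(Q, kernel p) = 0`, so
  -- `p` splits.
  obtain ⟨y, hy⟩ := Ext.covariant_sequence_exact₃ Q hS (Ext.mk₀ (𝟙 Q)) (zero_add 1)
    (key N 0 (by lia) _ (finite_of_mono (kernel.ι p)) _)
  obtain ⟨s, rfl⟩ := (Ext.mk₀_bijective _ _).surjective y
  rw [Ext.mk₀_comp_mk₀] at hy
  have hs : s ≫ p = 𝟙 Q := (Ext.mk₀_bijective _ _).injective hy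
  exact hP.of_retract ⟨s, p, hs⟩

theorem FactorsThroughProjective.mk {K P L : ModuleCat.{u} R} (hP : FGProj P) (a : K ⟶ P)
    (b : P ⟶ L) : FactorsThroughProjective (a ≫ b) := ⟨P, a, b, hP.1, hP.2, rfl⟩

/-- A map `f : K ⟶ L` of finitely generated modules, extended to an epimorphism `K ⊞ P ⟶ L` for
a projective module `P`, is an isomorphism in the stable category if and only if the kernel of the
epimorphism is projective. -/
theorem isStableIso_iff_fgProj_kernel (hR : Module.Injective R R) {K L P : ModuleCat.{u} R}
    (f : K ⟶ L) (p : P ⟶ L) (hP : FGProj P)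
    [Epi p] : IsStableIso f ↔ FGProj (kernel (biprod.desc f p)) := by
  have : Epi (biprod.desc f p) := by
    have : Epi (biprod.inr ≫ biprod.desc f p) := by rwa [biprod.inr_desc]
    exact epi_of_epi biprod.inr _
  set q := biprod.desc f p
  have hS : (ShortComplex.mk _ _ (kernel.condition q)).ShortExact :=
    { exact := ShortComplex.exact_kernel q }
  have hinl : biprod.inl ≫ q = f := biprod.inl_desc _ _
  have hinr : biprod.inr ≫ q = p := biprod.inr_desc _ _
  constructor
  · rintro ⟨g, ⟨A, a, b, hA₁, hA₂, hab⟩, ⟨B, c, d, hB₁, hB₂, hcd⟩⟩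
    have : Projective B := (IsProjective.iff_projective B).1 hB₁
    let d' := Projective.factorThru d q
    have hd' : d' ≫ q = d := Projective.factorThru_comp _ _
    -- The stable inverse `g` is a section of `q` up to the error `c ≫ d`, which lifts through `q`
    -- because `B` is projective and can be subtracted.
    let s : L ⟶ K ⊞ P := g ≫ biprod.inl - c ≫ d'
    have hs : s ≫ q = 𝟙 L := by
      simp only [s, Preadditive.sub_comp, Category.assoc, hinl, hd', hcd]
      abel
    have hA : FGProj A := ⟨hA₁, hA₂⟩
    let σ := ShortComplex.Splitting.ofExactOfSection _ hS.exact s hs inferInstance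
    have hσ : kernel.ι q ≫ σ.r = 𝟙 _ := σ.f_r
    -- On elements: if `f x + p y = 0`, applying `g` gives `x = -b (a x) - g (p y)`. So `(x, y)` is
    -- recovered from `(-a x, y)` in `A ⊞ P`, and since the kernel is a summand of `K ⊞ P`, it is a
    -- retract of `A ⊞ P`.
    have hι : kernel.ι q = biprod.lift (-(kernel.ι q ≫ biprod.fst ≫ a)) (kernel.ι q ≫ biprod.snd) ≫
        biprod.desc (b ≫ biprod.inl) (biprod.inr - p ≫ g ≫ biprod.inl) := by
      have h₁ : kernel.ι q ≫ (biprod.fst ≫ biprod.inl + biprod.snd ≫ biprod.inr) ≫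
          q ≫ g ≫ (biprod.inl : K ⟶ K ⊞ P) = 0 := by
        rw [biprod.total, Category.id_comp, kernel.condition_assoc, zero_comp]
      have h₂ : kernel.ι q ≫ (biprod.fst ≫ biprod.inl + biprod.snd ≫ biprod.inr) = kernel.ι q := by
        rw [biprod.total, Category.comp_id]
      have h₃ : f ≫ g ≫ biprod.inl = a ≫ b ≫ biprod.inl + (biprod.inl : K ⟶ K ⊞ P) := by
        rw [← Category.assoc, ← Category.assoc, hab]
        simp
      simp only [Preadditive.add_comp, Preadditive.comp_add, Category.assoc, reassoc_of% hinl,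
        reassoc_of% hinr, h₃] at h₁
      rw [biprod.lift_desc]
      conv_lhs => rw [← h₂]
      rw [← sub_eq_zero, ← h₁]
      simp only [Preadditive.comp_add, Preadditive.comp_sub, Preadditive.neg_comp, Category.assoc]
      abel
    refine (hA.biprod hP).of_retract
      ⟨biprod.lift (-(kernel.ι q ≫ biprod.fst ≫ a)) (kernel.ι q ≫ biprod.snd),
        biprod.desc (b ≫ biprod.inl) (biprod.inr - p ≫ g ≫ biprod.inl) ≫ σ.r, ?_⟩
    rw [← Category.assoc, ← hι, hσ]
  · intro hQ
    -- A projective kernel is injective, so the sequence splits. The first component of the section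
    -- is the stable inverse; the two errors factor through the kernel and through `P`.
    have := hQ.injective hR
    let r := Injective.factorThru (𝟙 _) (kernel.ι q)
    let σ := ShortComplex.Splitting.ofExactOfRetraction _ hS.exact r
      (Injective.comp_factorThru _ _) inferInstance
    have h₁ : σ.s ≫ q = 𝟙 L := σ.s_g
    have h₂ : r ≫ kernel.ι q + q ≫ σ.s = 𝟙 _ := σ.id
    have h₃ : f ≫ σ.s = biprod.inl - biprod.inl ≫ r ≫ kernel.ι q := by
      rw [← hinl, Category.assoc, eq_sub_of_add_eq' h₂, Preadditive.comp_sub, Category.comp_id]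
    have h₄ : q = biprod.fst ≫ f + biprod.snd ≫ p := by
      rw [← hinl, ← hinr, ← Category.assoc, ← Category.assoc, ← Preadditive.add_comp, biprod.total,
        Category.id_comp]
    refine ⟨σ.s ≫ biprod.fst, ?_, ?_⟩
    · have : f ≫ σ.s ≫ biprod.fst - 𝟙 K =
        (biprod.inl ≫ r) ≫ (-(kernel.ι q ≫ biprod.fst)) := by
        rw [← Category.assoc, h₃]
        simp
      rw [this]
      exact .mk hQ _ _
    · have : (σ.s ≫ biprod.fst) ≫ f - 𝟙 L = (σ.s ≫ biprod.snd) ≫ (-p) := by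
        have h₅ : σ.s ≫ (biprod.fst ≫ f + biprod.snd ≫ p) = 𝟙 L := by rw [← h₄, h₁]
        rw [← h₅]
        simp
      rw [this]
      exact .mk hP _ _

/-- A map between finitely generated modules over a Noetherian self-injective ring is an
isomorphism in the stable category if and only if its cone is perfect. -/
theorem isStableIso_iff_trW [IsNoetherianRing R] (hR : Module.Injective R R)
    [HasDerivedCategory.{w} (ModuleCat.{u} R)] {K L : ModuleCat.{u} R} [Module.Finite R K]
    [Module.Finite R L] (f : K ⟶ L) :
    IsStableIso f ↔ (perfect R).trW ((DerivedCategory.singleFunctor _ 0).map f) := by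
  obtain ⟨P, p, hP, _⟩ := exists_fgProj_epi L
  rw [isStableIso_iff_fgProj_kernel hR f p hP]
  have : Epi (biprod.desc f p) := by
    have : Epi (biprod.inr ≫ biprod.desc f p) := by rwa [biprod.inr_desc]
    exact epi_of_epi biprod.inr _
  have := hP.2
  have := finite_biprod K P
  have hS : (ShortComplex.mk _ _ (kernel.condition (biprod.desc f p))).ShortExact :=
    { exact := ShortComplex.exact_kernel _ }
  -- The cone of `biprod.inl` is `P`, so `f` and `biprod.desc f p` lie in `trW` simultaneously, and
  -- the cocone of the latter is its kernel.
  have h₁ : (perfect R).trW ((DerivedCategory.singleFunctor _ 0).map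
      (biprod.inl : K ⟶ K ⊞ P)) :=
    .mk _ (ShortComplex.Splitting.ofHasBinaryBiproduct K P).shortExact.singleTriangle_distinguished
      (perfect_single hP 0)
  have h₂ := (perfect R).trW_iff_of_distinguished' _ hS.singleTriangle_distinguished
  have h₃ := (perfect R).trW_precomp_iff _ ((DerivedCategory.singleFunctor _ 0).map
    (biprod.desc f p)) h₁
  rw [← Functor.map_comp, biprod.inl_desc] at h₃
  refine Iff.trans ?_ (h₃.trans h₂).symm
  have := finite_of_mono (kernel.ι (biprod.desc f p))
  exact ⟨fun h => perfect_single h 0, fun h => fgProj_of_isPerfect hR h⟩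

end SelfInjective

/-! ### Projective covers and Heller translates -/

section Heller

variable {R : Type u} [Ring R]

/-- Finitely generated modules over an Artinian ring have projective covers. -/
theorem exists_isProjectiveCover [IsArtinianRing R] (M : ModuleCat.{u} R) [Module.Finite R M] :
    ∃ (P : ModuleCat.{u} R) (π : P ⟶ M), IsProjectiveCover π := by
  obtain ⟨n, φ, hφ⟩ := Module.Finite.exists_fin' R M
  -- The cover is a minimal projective submodule of `R^n` that still maps onto `M`.
  obtain ⟨P, ⟨hP, hPφ⟩, hmin⟩ := IsArtinian.set_has_minimal
    {P : Submodule R (Fin n → R) | Module.Projective R P ∧ P.map φ = ⊤}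
    ⟨⊤, Module.Projective.of_equiv Submodule.topEquiv.symm, by
      rw [Submodule.map_top]; exact LinearMap.range_eq_top.2 hφ⟩
  let π : P →ₗ[R] M := φ ∘ₗ P.subtype
  have hπ : Function.Surjective π := by
    rw [← LinearMap.range_eq_top, LinearMap.range_comp, Submodule.range_subtype, hPφ]
  have : Module.Finite R P := Module.IsNoetherian.finite R P
  refine ⟨ModuleCat.of R P, ModuleCat.ofHom π, hP, this, hπ, fun (U : Submodule R P) hU => ?_⟩
  have hU' : Function.Surjective (π ∘ₗ U.subtype) := by
    have h : (U ⊔ LinearMap.ker π).map π = ⊤ := by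
      rw [show U ⊔ LinearMap.ker π = ⊤ from hU, Submodule.map_top]
      exact LinearMap.range_eq_top.2 hπ
    rw [Submodule.map_sup, LinearMap.le_ker_iff_map.1 le_rfl, sup_bot_eq] at h
    rw [← LinearMap.range_eq_top, LinearMap.range_comp, Submodule.range_subtype, h]
  -- This yields an endomorphism `e` of `P` over `M` with image in `U`. By Fitting's lemma the image
  -- of a high power of `e` is a direct summand, hence projective, and it still maps onto `M`;
  -- minimality makes it all of `P`. The exponent must be at least `1` for the image to lie in `U`.
  obtain ⟨h, hh⟩ := Module.projective_lifting_property _ π hU'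
  let e : Module.End R P := U.subtype ∘ₗ h
  have he : ∀ (m : ℕ) (x : P), π ((e ^ m) x) = π x := by
    intro m
    induction m with
    | zero => intro x; rfl
    | succ m ih =>
      intro x
      rw [pow_succ, Module.End.mul_apply, ih]
      exact congr($hh x)
  obtain ⟨m, hm, hm₁⟩ := (e.eventually_isCompl_ker_pow_range_pow.and
    (Filter.eventually_ge_atTop 1)).exists
  have hrange : LinearMap.range (e ^ m) ≤ U := by
    rintro _ ⟨x, rfl⟩
    obtain ⟨m, rfl⟩ := Nat.exists_eq_add_of_le' hm₁
    rw [pow_succ', Module.End.mul_apply]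
    exact (h _).2
  have hproj : Module.Projective R (LinearMap.range (e ^ m)) :=
    .of_split (LinearMap.range (e ^ m)).subtype
      (Submodule.projectionOnto _ _ hm.symm) (by
        ext x; simp)
  let P' := (LinearMap.range (e ^ m)).map P.subtype
  have hP' : ¬ P' < P := hmin P' ⟨Module.Projective.of_equiv
    (Submodule.equivMapOfInjective P.subtype P.subtype_injective _), by
      rw [← Submodule.map_comp, ← LinearMap.range_comp, LinearMap.range_eq_top]
      intro y
      obtain ⟨x, rfl⟩ := hπ y
      exact ⟨x, he m x⟩⟩
  have h₁ : P' = P := by_contra fun hne => hP' (lt_of_le_of_ne (Submodule.map_subtype_le _ _) hne)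
  rw [eq_top_iff]
  refine le_trans ?_ hrange
  rw [← Submodule.map_le_map_iff_of_injective P.subtype_injective, Submodule.map_subtype_top]
  exact h₁.ge

theorem IsHellerClass.finite [IsNoetherianRing R] {M : ModuleCat.{u} R} [Module.Finite R M] {n : ℕ}
    {K : ModuleCat.{u} R} {ξ : Ext.{u} M K n} (h : IsHellerClass M n K ξ) :
    Module.Finite R K := by
  induction h with
  | zero => infer_instance
  | succ S hS hg ξ hξ ih =>
    have := hS.mono_f
    have := hg.finite
    exact finite_of_mono S.f

theorem exists_isHellerClass [IsArtinianRing R] (M : ModuleCat.{u} R) [Module.Finite R M]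
    (n : ℕ) : ∃ (K : ModuleCat.{u} R) (ξ : Ext.{u} M K n), IsHellerClass M n K ξ := by
  induction n with
  | zero => exact ⟨M, _, .zero⟩
  | succ n ih =>
    obtain ⟨L, ξ, hξ⟩ := ih
    have := hξ.finite
    obtain ⟨P, π, hπ⟩ := exists_isProjectiveCover L
    have : Epi π := (ModuleCat.epi_iff_surjective π).2 hπ.surjective
    exact ⟨_, _, .succ (ShortComplex.mk _ _ (kernel.condition π))
      { exact := ShortComplex.exact_kernel π } hπ ξ hξ⟩

/-- Every class in `Ext^(n+i)(M, V)` is the product of the class of the truncated minimal projective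
resolution of `M` with a class in `Ext^i(Ω^n(M), V)`. -/
theorem IsHellerClass.exists_comp_eq {M : ModuleCat.{u} R} {n : ℕ} {K : ModuleCat.{u} R}
    {ξ : Ext.{u} M K n} (h : IsHellerClass M n K ξ) {V : ModuleCat.{u} R} {i j : ℕ}
    (hij : n + i = j) (y : Ext.{u} M V j) : ∃ z : Ext.{u} K V i, ξ.comp z hij = y := by
  induction h generalizing i with
  | zero =>
    obtain rfl : i = j := by lia
    exact ⟨y, Ext.mk₀_id_comp y⟩
  | succ S hS hg ξ hξ ih =>
    -- The induction hypothesis is needed one degree higher: `z` has positive degree, so it dies on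
    -- the projective `S.X₂` and factors through the extension class.
    obtain ⟨z, rfl⟩ := ih (i := i + 1) (by lia)
    have : Projective S.X₂ := (IsProjective.iff_projective _).1 hg.projective
    obtain ⟨x, rfl⟩ := Ext.contravariant_sequence_exact₃ hS V z (Ext.eq_zero_of_projective _)
      (add_comm 1 i)
    exact ⟨x, Ext.comp_assoc _ _ _ rfl (add_comm 1 i) (by lia)⟩

variable [HasDerivedCategory.{w} (ModuleCat.{u} R)]

/-- A Yoneda product is `α` followed by a shift of `β`, and `trW` is invariant under shifts, so `α`
can be cancelled. -/
theorem trW_comp {X Y Z : ModuleCat.{u} R} {a b c : ℕ} (h : a + b = c) (α : Ext.{u} X Y a)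
    (β : Ext.{u} Y Z b) (hα : (perfect R).trW α.hom) :
    (perfect R).trW (α.comp β h).hom ↔ (perfect R).trW β.hom := by
  rw [Ext.comp_hom, ShiftedHom.comp, (perfect R).trW_precomp_iff _ _ hα,
    (perfect R).trW.cancel_right_of_respectsIso]
  exact ⟨fun h => h.unshift, fun h => h.shift _⟩

theorem trW_mk₀_iff {X Y : ModuleCat.{u} R} (f : X ⟶ Y) : (perfect R).trW (Ext.mk₀ f).hom ↔
    (perfect R).trW ((DerivedCategory.singleFunctor _ 0).map f) := by
  rw [Ext.mk₀_hom, ShiftedHom.mk₀, (perfect R).trW.cancel_right_of_respectsIso]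

/-- The class of the truncated minimal projective resolution has a perfect cone. -/
theorem IsHellerClass.trW {M : ModuleCat.{u} R} {n : ℕ} {K : ModuleCat.{u} R}
    {ξ : Ext.{u} M K n} (h : IsHellerClass M n K ξ) : (perfect R).trW ξ.hom := by
  induction h with
  | zero =>
    rw [trW_mk₀_iff, CategoryTheory.Functor.map_id]
    exact (perfect R).trW.id_mem _
  | succ S hS hg ξ hξ ih =>
    rw [trW_comp _ _ _ ih, ShortComplex.ShortExact.extClass_hom]
    -- After rotation, the cocone of the connecting map is the projective middle term.
    exact .mk' _ (Pretriangulated.rot_of_distTriang _ hS.singleTriangle_distinguished)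
      (perfect_single ⟨hg.projective, hg.finite⟩ 0)

end Heller

/-! ### Left derived functors and distinguished triangles -/

section Derived

open DerivedCategory Pretriangulated

variable {C : Type u} [Category.{v} C] [Abelian C] [HasDerivedCategory.{w} C]

/-- Isomorphic objects of the derived category are isomorphic in the homotopy category if they
are left orthogonal to the acyclic complexes. -/
theorem nonempty_iso_of_leftOrthogonal {K L : HomotopyCategory C (.up ℤ)}
    (hK : (HomotopyCategory.subcategoryAcyclic C).leftOrthogonal K)
    (hL : (HomotopyCategory.subcategoryAcyclic C).leftOrthogonal L) (e : Qh.obj K ≅ Qh.obj L) :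
    Nonempty (K ≅ L) := by
  obtain ⟨f, hf⟩ := (hK.map_bijective_of_isTriangulated Qh L).surjective e.hom
  obtain ⟨g, hg⟩ := (hL.map_bijective_of_isTriangulated Qh K).surjective e.inv
  exact ⟨f, g, (hK.map_bijective_of_isTriangulated Qh _).injective (by simp [hf, hg]),
    (hL.map_bijective_of_isTriangulated Qh _).injective (by simp [hf, hg])⟩

variable [EnoughProjectives C]

theorem projRes_leftOrthogonal (X : DerivedCategory.Minus C) :
    (HomotopyCategory.subcategoryAcyclic C).leftOrthogonal (projResFunctor.obj X) := by
  obtain ⟨⟨d, hd⟩, hP, -⟩ := (exists_projective_iso X).choose_spec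
  have : (projRes X).IsStrictlyLE d := hd
  have : ∀ i, Projective ((projRes X).X i) := hP
  have : (projRes X).IsKProjective := CochainComplex.isKProjective_of_projective _ d
  exact CochainComplex.IsKProjective.leftOrthogonal _

variable {D : Type u'} [Category.{v'} D] [Abelian D] [HasDerivedCategory.{w'} D]
  (F : C ⥤ D) [F.Additive]

/-- The left derived functor preserves cocones. -/
theorem leftDerived_distinguished {X Y Z : DerivedCategory.Minus C} (f : X.obj ⟶ Y.obj)
    (g : Y ⟶ Z) (δ : Z.obj ⟶ X.obj⟦(1 : ℤ)⟧) (h : Triangle.mk f g.hom δ ∈ distTriang _) :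
    ∃ (f' : (leftDerived F).obj X ⟶ (leftDerived F).obj Y)
      (δ' : (leftDerived F).obj Z ⟶ ((leftDerived F).obj X)⟦(1 : ℤ)⟧),
      Triangle.mk f' ((leftDerived F).map g) δ' ∈ distTriang _ := by
  -- The cocone is formed in the homotopy category, between the resolutions, where termwise
  -- application of `F` preserves triangles. It is left orthogonal to the acyclic complexes and
  -- becomes isomorphic to `X` in the derived category, so it is already homotopy equivalent to the
  -- resolution of `X`.
  obtain ⟨K, a, b, hK⟩ := distinguished_cocone_triangle₁ (projResFunctor.map g)
  have hK' := ObjectProperty.ext_of_isTriangulatedClosed₁ _ _ hK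
    (projRes_leftOrthogonal Y) (projRes_leftOrthogonal Z)
  obtain ⟨e, -⟩ := exists_iso_of_arrow_iso _ _
    (rot_of_distTriang _ (Qh.map_distinguished _ hK)) (rot_of_distTriang _ h)
    (Arrow.isoMk (projResIso Y) (projResIso Z) (by
      change (projResIso Y).hom ≫ g.hom = Qh.map (projResLift _) ≫ (projResIso Z).hom
      simp))
  let e₁ : Qh.obj K ≅ X.obj :=
    (CategoryTheory.shiftFunctor (DerivedCategory C) (1 : ℤ)).preimageIso (Triangle.π₃.mapIso e)
  obtain ⟨i⟩ : Nonempty (projResFunctor.obj X ≅ K) :=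
    nonempty_iso_of_leftOrthogonal (projRes_leftOrthogonal X) hK' (projResIso X ≪≫ e₁.symm)
  have hX : Triangle.mk (i.hom ≫ a) (projResFunctor.map g) (b ≫ i.inv⟦(1 : ℤ)⟧') ∈ distTriang _ :=
    isomorphic_distinguished _ hK _ (Triangle.isoMk _ _ i (Iso.refl _) (Iso.refl _)
      (Category.comp_id (i.hom ≫ a)) ((Category.comp_id _).trans (Category.id_comp _).symm) (by
        change (b ≫ i.inv⟦(1 : ℤ)⟧') ≫ i.hom⟦(1 : ℤ)⟧' = 𝟙 _ ≫ b
        rw [Category.assoc, ← Functor.map_comp, i.inv_hom_id, CategoryTheory.Functor.map_id,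
          Category.comp_id, Category.id_comp]))
  exact ⟨_, _, Qh.map_distinguished _ ((F.mapHomotopyCategory (.up ℤ)).map_distinguished _ hX)⟩

/-- A criterion for the counit `LF(X) ⟶ F(L)` to be invertible: the functor `F` becomes,
after application of the exact conservative functor `U`, a functor which factors through an exact
functor `r` for which the terms of `L` are projective. -/
theorem isIso_leftDerivedTo {C' : Type*} [Category* C'] [Abelian C'] {D' : Type*} [Category* D']
    [Abelian D'] (r : C ⥤ C') [PreservesFiniteLimits r] [PreservesFiniteColimits r]
    (hr : ∀ P : C, Projective P → Projective (r.obj P)) (G : C' ⥤ D') [G.Additive] (U : D ⥤ D')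
    [PreservesFiniteLimits U] [PreservesFiniteColimits U] [U.ReflectsIsomorphisms]
    (e : r ⋙ G ≅ F ⋙ U) {X : DerivedCategory.Minus C} (L : CochainComplex C ℤ) (d : ℤ)
    [L.IsStrictlyLE d] (hL : ∀ i, Projective (r.obj (L.X i)))
    {K : HomotopyCategory C (.up ℤ)} (i : K ≅ (HomotopyCategory.quotient C (.up ℤ)).obj L)
    (f : X.obj ⟶ Qh.obj K) (hf : IsIso f) : IsIso (leftDerivedTo F f) := by
  have : r.Additive := Functor.additive_of_preserves_binary_products r
  have : U.Additive := Functor.additive_of_preserves_binary_products U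
  obtain ⟨φ, hφ⟩ := (HomotopyCategory.quotient C (.up ℤ)).map_surjective (projResLift f ≫ i.hom)
  have h₁ : QuasiIso φ := by
    rw [← isIso_Q_map_iff_quasiIso, ← NatIso.isIso_map_iff (quotientCompQhIso C)]
    change IsIso (Qh.map ((HomotopyCategory.quotient C (.up ℤ)).map φ))
    rw [hφ, Functor.map_comp, Qh_map_projResLift]
    infer_instance
  obtain ⟨⟨d', hd'⟩, hP, -⟩ := (exists_projective_iso X).choose_spec
  have hd'' : (projRes X).IsStrictlyLE d' := hd'
  have hLE (K : CochainComplex C ℤ) (c : ℤ) [K.IsStrictlyLE c] :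
      CochainComplex.IsStrictlyLE ((r.mapHomologicalComplex (.up ℤ)).obj K) c := by
    rw [CochainComplex.isStrictlyLE_iff]
    intro i hi
    exact r.map_isZero (K.isZero_of_isStrictlyLE c i hi)
  have hP' : ∀ i, Projective (((r.mapHomologicalComplex (.up ℤ)).obj (projRes X)).X i) :=
    fun i => hr _ (hP i)
  have hL' : ∀ i, Projective (((r.mapHomologicalComplex (.up ℤ)).obj L).X i) := hL
  have := hLE L d
  have := hLE (projRes X) d'
  have := CochainComplex.isKProjective_of_projective
    ((r.mapHomologicalComplex (.up ℤ)).obj (projRes X)) d'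
  have := CochainComplex.isKProjective_of_projective ((r.mapHomologicalComplex (.up ℤ)).obj L) d
  -- A quasi-isomorphism between bounded above complexes of projectives is a homotopy equivalence,
  -- which every additive functor, in particular `G`, preserves.
  have h₂ : QuasiIso ((r.mapHomologicalComplex (.up ℤ)).map φ) := inferInstance
  obtain ⟨η, hη⟩ := (CochainComplex.IsKProjective.quasiIso_iff _).1 h₂
  have h₃ : QuasiIso ((G.mapHomologicalComplex (.up ℤ)).map
      ((r.mapHomologicalComplex (.up ℤ)).map φ)) := by
    rw [← hη]
    exact (G.mapHomotopyEquiv η).quasiIso_hom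
  have h₄ : QuasiIso ((U.mapHomologicalComplex (.up ℤ)).map
      ((F.mapHomologicalComplex (.up ℤ)).map φ)) := by
    have := (NatIso.mapHomologicalComplex e (.up ℤ)).hom.naturality φ
    exact (quasiIso_iff_of_arrow_mk_iso _ _ (Arrow.isoMk
      ((NatIso.mapHomologicalComplex e (.up ℤ)).app _)
      ((NatIso.mapHomologicalComplex e (.up ℤ)).app _) this.symm)).1 h₃
  -- Being exact and conservative, `U` reflects quasi-isomorphisms, so `F` applied to `φ` is one.
  rw [HomologicalComplex.quasiIso_map_iff_of_preservesHomology] at h₄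
  rw [← isIso_Q_map_iff_quasiIso, ← NatIso.isIso_map_iff (quotientCompQhIso D)] at h₄
  change IsIso (Qh.map ((F.mapHomotopyCategory (.up ℤ)).map
    ((HomotopyCategory.quotient C (.up ℤ)).map φ))) at h₄
  rw [hφ, Functor.map_comp, Functor.map_comp] at h₄
  exact @IsIso.of_isIso_comp_right _ _ _ _ _ _ (Qh.map ((F.mapHomotopyCategory (.up ℤ)).map i.hom))
    inferInstance h₄

omit [HasDerivedCategory.{w} C] [EnoughProjectives C] in
theorem projective_single_X {C' : Type*} [Category* C'] [Abelian C'] (r : C ⥤ C')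
    [PreservesFiniteLimits r] {X : C} (hX : Projective (r.obj X)) (i : ℤ) :
    Projective (r.obj (((CochainComplex.singleFunctor C 0).obj X).X i)) := by
  have : r.Additive := Functor.additive_of_preserves_binary_products r
  by_cases h : i = 0
  · subst h
    exact Projective.of_iso (r.mapIso (HomologicalComplex.singleObjXSelf (.up ℤ) 0 X).symm) hX
  · exact (r.map_isZero (HomologicalComplex.isZero_single_obj_X (.up ℤ) 0 X i h)).projective

/-! ### Objects that become projective under `r` are acyclic for `F` -/

section Acyclic

variable {C' : Type*} [Category* C'] [Abelian C'] {D' : Type*} [Category* D']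
    [Abelian D'] (r : C ⥤ C') [PreservesFiniteLimits r] [PreservesFiniteColimits r]
    (hr : ∀ P : C, Projective P → Projective (r.obj P)) (G : C' ⥤ D') [G.Additive] (U : D ⥤ D')
    [PreservesFiniteLimits U] [PreservesFiniteColimits U] [U.ReflectsIsomorphisms]
    (e : r ⋙ G ≅ F ⋙ U) {X : C} (hX : Projective (r.obj X)) {V : D} (a : F.obj X ≅ V)

include hr e hX

theorem isIso_leftDerivedToSingle : IsIso (leftDerivedToSingle F a.hom) := by
  have := isIso_leftDerivedTo F r hr G U e (X := minusSingle X)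
    ((CochainComplex.singleFunctor C 0).obj X) 0 (projective_single_X r hX)
    (K := (HomotopyCategory.singleFunctor C 0).obj X) (Iso.refl _) (𝟙 _) (IsIso.id _)
  exact IsIso.comp_isIso' this inferInstance

theorem isIso_leftDerivedToSingleShift (n : ℕ) :
    IsIso (leftDerivedToSingleShift F n a.hom) := by
  have := ((CochainComplex.singleFunctor C 0).obj X).isStrictlyLE_shift 0 (n : ℤ) (-n) (by lia)
  have := isIso_leftDerivedTo F r hr G U e (X := minusSingleShift X n)
    (((CochainComplex.singleFunctor C 0).obj X)⟦(n : ℤ)⟧) (-n)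
    (fun i => projective_single_X r hX (i + n))
    (K := ((HomotopyCategory.singleFunctor C 0).obj X)⟦(n : ℤ)⟧)
    (((HomotopyCategory.quotient C (.up ℤ)).commShiftIso (n : ℤ)).symm.app
      ((CochainComplex.singleFunctor C 0).obj X))
    ((Qh.commShiftIso (n : ℤ)).inv.app _) ((Qh.commShiftIso (n : ℤ)).symm.app _).isIso_hom
  exact IsIso.comp_isIso' this inferInstance

end Acyclic

end Derived

/-! ### The characterization of strong periodicity by perfectness -/

section Periodic

open Pretriangulated

variable {A R : Type u} [Ring A] [Ring R] [HasDerivedCategory.{w} (ModuleCat.{u} A)]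
  [HasDerivedCategory.{w'} (ModuleCat.{u} R)]
  (F : ModuleCat.{u} A ⥤ ModuleCat.{u} R) [F.Additive]

/-- Invertibility of both counits makes `LF(α)` and its derived image `β` isomorphic arrows, so they
lie in `trW` together; cancelling the Heller class then passes from `β` to the stable map. -/
theorem inducesStableIso_iff_isPerfect [IsArtinianRing R] (hR : Module.Injective R R)
    {X X' : ModuleCat.{u} A} {V V' : ModuleCat.{u} R} [Module.Finite R V] [Module.Finite R V']
    (a : F.obj X ≅ V) (b : F.obj X' ≅ V') {n : ℕ} (α : Ext.{u} X X' n)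
    (ha : IsIso (leftDerivedToSingle F a.hom)) (hb : IsIso (leftDerivedToSingleShift F n b.hom))
    (Y : DerivedCategory.Minus (ModuleCat.{u} A))
    (f : Y.obj ⟶ (DerivedCategory.singleFunctor _ 0).obj X)
    (δ : ((DerivedCategory.singleFunctor _ 0).obj X')⟦(n : ℤ)⟧ ⟶ Y.obj⟦(1 : ℤ)⟧)
    (hY : Triangle.mk f α.hom δ ∈ distTriang _) :
    InducesStableIso F a b α ↔ IsPerfect ((leftDerived F).obj Y) := by
  obtain ⟨f', δ', hY'⟩ := leftDerived_distinguished F (Y := minusSingle X)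
    (Z := minusSingleShift X' n) f (extMinus α) δ hY
  have h₁ := (perfect R).trW_iff_of_distinguished' _ hY'
  -- The equivalence holds for every choice of Heller translate and of representing map, so in one
  -- direction any given choice serves and in the other it suffices to produce one.
  have key {K : ModuleCat.{u} R} {ξ : Ext.{u} V K n} {g : K ⟶ V'} (hξ : IsHellerClass V n K ξ)
      (hg : IsDerivedImage F a b α (ξ.comp (Ext.mk₀ g) (add_zero n))) :
      IsStableIso g ↔ IsPerfect ((leftDerived F).obj Y) := by
    have := hξ.finite
    rw [isStableIso_iff_trW hR, ← trW_mk₀_iff, ← trW_comp (add_zero n) ξ _ hξ.trW]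
    refine Iff.trans ?_ h₁
    change _ ↔ (perfect R).trW ((leftDerived F).map (extMinus α))
    rw [← (perfect R).trW.cancel_right_of_respectsIso _ (leftDerivedToSingleShift F n b.hom), hg,
      (perfect R).trW.cancel_left_of_respectsIso]
  constructor
  · rintro ⟨K, ξ, g, hξ, hg, hs⟩
    exact (key hξ hg).1 hs
  · intro hp
    obtain ⟨K, ξ, hξ⟩ := exists_isHellerClass V n
    -- The derived image is obtained by transporting `LF(α)` along the inverse counit.
    obtain ⟨β, hβ⟩ := (Ext.homEquiv (X := V) (Y := V') (n := n)).surjective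
      (inv (leftDerivedToSingle F a.hom) ≫ (leftDerived F).map (extMinus α) ≫
        leftDerivedToSingleShift F n b.hom)
    obtain ⟨z, rfl⟩ := hξ.exists_comp_eq (add_zero n) β
    obtain ⟨g, rfl⟩ := (Ext.mk₀_bijective _ _).surjective z
    have hg : IsDerivedImage F a b α (ξ.comp (Ext.mk₀ g) (add_zero n)) := by
      have hβ' : (ξ.comp (Ext.mk₀ g) (add_zero n)).hom = _ := hβ
      rw [IsDerivedImage, hβ', IsIso.hom_inv_id_assoc]
    exact ⟨K, ξ, g, hξ, hg, (key hξ hg).2 hp⟩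

end Periodic

/-! ### Tensor products after restriction of scalars -/

section Restriction

variable {R R' S T : Type u} [Ring R] [Ring R'] [Ring S] [Ring T]

/-- When the actions of `S` and `T` commute, the relations span an additive subgroup. -/
theorem balancedRelations_toAddSubgroup (i : S →+* R) (j : T → R)
    (hij : ∀ s t, i s * j t = j t * i s) (M : ModuleCat.{u} T) (X : ModuleCat.{u} R) :
    (balancedRelations i j M X).toAddSubgroup = AddSubgroup.closure {z | ∃ (x : X) (t : T) (m : M),
      z = (show (ModuleCat.restrictScalars i).obj X from j t • x) ⊗ₜ[ℤ] m -
        (show (ModuleCat.restrictScalars i).obj X from x) ⊗ₜ[ℤ] (t • m)} := by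
  refine le_antisymm (fun z hz => ?_) ((AddSubgroup.closure_le _).2 Submodule.subset_span)
  refine Submodule.span_induction (p := fun z _ => z ∈ AddSubgroup.closure _)
    (fun z hz => AddSubgroup.subset_closure hz) (zero_mem _) (fun _ _ _ _ => add_mem) ?_ hz
  intro s z hz' hz
  clear hz'
  induction hz using AddSubgroup.closure_induction with
  | mem z hz =>
    obtain ⟨x, t, m, rfl⟩ := hz
    -- Since `i s` and `j t` commute, `s` sends the relation of `(x, t, m)` to that of `(i s • x, t,
    -- m)`.
    refine AddSubgroup.subset_closure ⟨i s • x, t, m, ?_⟩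
    rw [smul_sub, TensorProduct.smul_tmul', TensorProduct.smul_tmul', ← mul_smul, ← hij, mul_smul]
    rfl
  | zero => rw [smul_zero]; exact zero_mem _
  | add a b _ _ ha hb => rw [smul_add]; exact add_mem ha hb
  | neg a _ ha => rw [smul_neg]; exact neg_mem ha

theorem add_balancedTmul (i : S →+* R) (j : T → R) {M : ModuleCat.{u} T} {X : ModuleCat.{u} R}
    (x x' : X) (m : M) :
    balancedTmul i j (x + x') m = balancedTmul i j x m + balancedTmul i j x' m :=
  congrArg (Submodule.mkQ (balancedRelations i j M X)) (TensorProduct.add_tmul _ _ _)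

/-- The class of the pure tensor `x ⊗ m` as a biadditive map. -/
noncomputable def balancedTmulHom (i : S →+* R) (j : T → R) (M : ModuleCat.{u} T)
    (X : ModuleCat.{u} R) : X →+ M →+ (balancedTensor i j M).obj X :=
  AddMonoidHom.mk' (fun x => AddMonoidHom.mk' (balancedTmul i j x) (balancedTmul_add i j x))
    (fun x x' => AddMonoidHom.ext fun m => add_balancedTmul i j x x' m)

/-- The additive map out of the tensor product attached to a balanced biadditive map. -/
noncomputable def balancedLift (i : S →+* R) (j : T → R) (hij : ∀ s t, i s * j t = j t * i s)
    {M : ModuleCat.{u} T} {X : ModuleCat.{u} R} {W : Type u} [AddCommGroup W] (μ : X →+ M →+ W)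
    (hμ : ∀ (x : X) (t : T) (m : M), μ (j t • x) m = μ x (t • m)) :
    (balancedTensor i j M).obj X →+ W :=
  QuotientAddGroup.lift (balancedRelations i j M X).toAddSubgroup
    (TensorProduct.liftAddHom (R := ℤ) (M := (ModuleCat.restrictScalars i).obj X) μ
      (fun r x m =>
        (congrArg (fun h : M →+ W => h m) (map_zsmul μ r (show X from x))).trans
          (map_zsmul (μ (show X from x)) r m).symm)) (by
    rw [balancedRelations_toAddSubgroup i j hij, AddSubgroup.closure_le]
    rintro _ ⟨x, t, m, rfl⟩
    refine (map_sub (TensorProduct.liftAddHom (R := ℤ) (M := (ModuleCat.restrictScalars i).obj X)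
      μ _) _ _).trans ?_
    exact sub_eq_zero.2 (hμ x t m))

/-- The underlying abelian group of a tensor product only depends on the action of the ring over
which the tensor product is taken. -/
noncomputable def restrictBalancedTensor (i : S →+* R) (l : R' →+* R) (j : T → R')
    (hij : ∀ s t, i s * l (j t) = l (j t) * i s) (M : ModuleCat.{u} T) :
    ModuleCat.restrictScalars l ⋙
        (balancedTensor ((Int.castRingHom R').comp ULift.ringEquiv.{0, u}.toRingHom) j M ⋙
          forget₂ (ModuleCat.{u} (ULift.{u} ℤ)) AddCommGrpCat.{u}) ≅
      balancedTensor i (fun t => l (j t)) M ⋙ forget₂ (ModuleCat.{u} S) AddCommGrpCat.{u} :=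
  -- Here `ULift ℤ` replaces `S`, leaving only the additive structure; it acts through central
  -- integers.
  have hc : ∀ s t, (Int.castRingHom R').comp ULift.ringEquiv.{0, u}.toRingHom s * j t =
    j t * (Int.castRingHom R').comp ULift.ringEquiv.{0, u}.toRingHom s :=
    fun _ _ => (Int.cast_commute _ _).eq
  NatIso.ofComponents
    (fun X => AddEquiv.toAddCommGrpIso (AddMonoidHom.toAddEquiv
      (balancedLift _ j hc (X := (ModuleCat.restrictScalars l).obj X)
        (balancedTmulHom i (fun t => l (j t)) M X)
        (fun x t m => balancedTmul_smul i (fun t => l (j t)) (show X from x) t m))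
      (balancedLift i (fun t => l (j t)) hij
        (balancedTmulHom _ j M ((ModuleCat.restrictScalars l).obj X))
        (fun x t m => balancedTmul_smul _ j (X := (ModuleCat.restrictScalars l).obj X) x t m))
      (balancedTensor_ext fun _ _ => rfl) (balancedTensor_ext fun _ _ => rfl)))
    (fun _ => AddCommGrpCat.hom_ext (balancedTensor_ext fun _ _ => rfl))

theorem exact_restrictScalars (f : R →+* S) :
    PreservesFiniteLimits (ModuleCat.restrictScalars.{u} f) ∧
      PreservesFiniteColimits (ModuleCat.restrictScalars.{u} f) := by
  refine ((Functor.exact_tfae (ModuleCat.restrictScalars.{u} f)).out 1 3).mp fun T hT => ?_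
  rw [ShortComplex.ShortExact.moduleCat_exact_iff_function_exact] at hT ⊢
  exact hT

instance (f : R →+* S) : PreservesFiniteLimits (ModuleCat.restrictScalars.{u} f) :=
  (exact_restrictScalars f).1

instance (f : R →+* S) : PreservesFiniteColimits (ModuleCat.restrictScalars.{u} f) :=
  (exact_restrictScalars f).2

/-- Restriction of scalars along `f : R ⟶ S` preserves projective modules if `S` is projective over
`R`. -/
theorem projective_restrictScalars (f : R →+* S)
    (hf : Projective ((ModuleCat.restrictScalars f).obj (ModuleCat.of S S)))
    (P : ModuleCat.{u} S) (hP : Projective P) :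
    Projective ((ModuleCat.restrictScalars f).obj P) := by
  let _ := Module.compHom S f
  let _ := Module.compHom P f
  have : IsScalarTower R S P := ⟨fun r s p => mul_smul (f r) s p⟩
  have : Module.Projective R S := (IsProjective.iff_projective _).2 hf
  have : Module.Projective S P := (IsProjective.iff_projective _).2 hP
  obtain ⟨g, hg⟩ := (Module.projective_def'.1 this)
  have : IsScalarTower R S (P →₀ S) := ⟨fun r s p => by
    ext x; exact mul_assoc (f r) s (p x)⟩
  have : LinearMap.CompatibleSMul P (P →₀ S) R S := ⟨fun g c x => g.map_smul (f c) x⟩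
  -- Over `S`, `P` is a retract of `P →₀ S`, which over `R` is a direct sum of copies of the
  -- projective module `S`.
  have : Module.Projective R (P →₀ S) :=
    have := Classical.decEq P
    have := fun s : S => Classical.dec (s ≠ 0)
    Module.Projective.of_equiv (finsuppLequivDFinsupp R).symm
  have h : Module.Projective R P := .of_split (g.restrictScalars R)
    ((Finsupp.linearCombination S id).restrictScalars R) (by ext x; exact congr($hg x))
  exact (IsProjective.iff_projective _).1 h

theorem projective_of_addEquiv {Q : Type u} [AddCommGroup Q] [Module R Q] [Module.Projective R Q]
    {M : ModuleCat.{u} R} (e : M ≃+ Q) (he : ∀ (r : R) (m : M), e (r • m) = r • e m) :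
    Projective M :=
  (IsProjective.iff_projective M).1 (Module.Projective.of_equiv
    ({ e with map_smul' := he } : M ≃ₗ[R] Q).symm)

end Restriction

/-! ### One-sided restrictions of bimodules -/

section Enveloping
open MulOpposite

variable (k : Type v) (E : Type u) [Field k] [Ring E] [Algebra k E]

/-- Over the field `k`, the ring `E ⊗ Eᵐᵒᵖ` is a base change of a free `k`-module, hence projective
over `E`. -/
theorem projective_restrictScalars_includeLeft (P : Bimod k E) (hP : Projective P) :
    Projective ((ModuleCat.restrictScalars (Algebra.TensorProduct.includeLeftRingHom
      (R := k) (A := E) (B := Eᵐᵒᵖ))).obj P) := by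
  refine projective_restrictScalars _ ?_ P hP
  refine projective_of_addEquiv (Q := E ⊗[k] Eᵐᵒᵖ) (AddEquiv.refl (E ⊗[k] Eᵐᵒᵖ)) fun a x => ?_
  change (a ⊗ₜ[k] (1 : Eᵐᵒᵖ)) * (show E ⊗[k] Eᵐᵒᵖ from x) = a • (show E ⊗[k] Eᵐᵒᵖ from x)
  induction (show E ⊗[k] Eᵐᵒᵖ from x) using TensorProduct.induction_on with
  | zero => rw [smul_zero, mul_zero]
  | add x y hx hy => rw [smul_add, mul_add, hx, hy]
  | tmul x y =>
    rw [TensorProduct.smul_tmul', Algebra.TensorProduct.tmul_mul_tmul, one_mul, smul_eq_mul]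

theorem projective_restrictScalars_includeRight (P : Bimod k E) (hP : Projective P) :
    Projective ((ModuleCat.restrictScalars (Algebra.TensorProduct.includeRight
      (R := k) (A := E) (B := Eᵐᵒᵖ)).toRingHom).obj P) := by
  refine projective_restrictScalars _ ?_ P hP
  refine projective_of_addEquiv (Q := Eᵐᵒᵖ ⊗[k] E)
    (TensorProduct.comm k E Eᵐᵒᵖ).toAddEquiv fun a x => ?_
  change TensorProduct.comm k E Eᵐᵒᵖ (((1 : E) ⊗ₜ[k] a) * (show E ⊗[k] Eᵐᵒᵖ from x)) =
    a • TensorProduct.comm k E Eᵐᵒᵖ (show E ⊗[k] Eᵐᵒᵖ from x)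
  induction (show E ⊗[k] Eᵐᵒᵖ from x) using TensorProduct.induction_on with
  | zero => rw [mul_zero, map_zero, smul_zero]
  | add x y hx hy => rw [mul_add, map_add, map_add, smul_add, hx, hy]
  | tmul x y =>
    rw [Algebra.TensorProduct.tmul_mul_tmul, TensorProduct.comm_tmul, TensorProduct.comm_tmul,
      TensorProduct.smul_tmul', one_mul, smul_eq_mul]

variable {k E}

theorem projective_restrictScalars_includeRight_regularBimod :
    Projective ((ModuleCat.restrictScalars (Algebra.TensorProduct.includeRight
      (R := k) (A := E) (B := Eᵐᵒᵖ)).toRingHom).obj (regularBimod k E)) :=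
  projective_of_addEquiv (Q := Eᵐᵒᵖ) (MulOpposite.opAddEquiv (α := E)) (fun b x => by
    have h := regularBimod_smul (k := k) 1 b (show E from x)
    rw [one_mul] at h
    exact congrArg op h)

theorem projective_restrictScalars_includeLeft_regularBimod :
    Projective ((ModuleCat.restrictScalars (Algebra.TensorProduct.includeLeftRingHom
      (R := k) (A := E) (B := Eᵐᵒᵖ))).obj (regularBimod k E)) :=
  projective_of_addEquiv (Q := E) (AddEquiv.refl E) (fun a x => by
    have h := regularBimod_smul (k := k) a 1 (show E from x)
    rw [unop_one, mul_one] at h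
    exact h)

/-- The twist by `σ` alters the left action only, so the right module is still the regular one. -/
theorem projective_restrictScalars_includeRight_twistedBimod (σ : E ≃ₐ[k] E) :
    Projective ((ModuleCat.restrictScalars (Algebra.TensorProduct.includeRight
      (R := k) (A := E) (B := Eᵐᵒᵖ)).toRingHom).obj (twistedBimod σ AlgEquiv.refl)) :=
  projective_of_addEquiv (Q := Eᵐᵒᵖ) (MulOpposite.opAddEquiv (α := E)) (fun b x => by
    have h := twistedBimod_smul σ AlgEquiv.refl 1 b (show E from x)
    rw [map_one, one_mul] at h
    exact congrArg op h)

theorem projective_restrictScalars_includeLeft_twistedBimod (τ : E ≃ₐ[k] E) :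
    Projective ((ModuleCat.restrictScalars (Algebra.TensorProduct.includeLeftRingHom
      (R := k) (A := E) (B := Eᵐᵒᵖ))).obj (twistedBimod AlgEquiv.refl τ)) :=
  projective_of_addEquiv (Q := E) (AddEquiv.refl E) (fun a x => by
    have h := twistedBimod_smul AlgEquiv.refl τ a 1 (show E from x)
    rw [unop_one, map_one, mul_one] at h
    exact h)

variable (k) in
/-- The underlying abelian group of `X ⊗_E M` only depends on `X` as a right module. -/
noncomputable def restrictTensorLeftModule (M : ModuleCat.{u} E) :
    ModuleCat.restrictScalars (Algebra.TensorProduct.includeRight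
        (R := k) (A := E) (B := Eᵐᵒᵖ)).toRingHom ⋙
        (balancedTensor ((Int.castRingHom Eᵐᵒᵖ).comp ULift.ringEquiv.{0, u}.toRingHom) op M ⋙
          forget₂ (ModuleCat.{u} (ULift.{u} ℤ)) AddCommGrpCat.{u}) ≅
      tensorLeftModule k M ⋙ forget₂ (ModuleCat.{u} E) AddCommGrpCat.{u} :=
  restrictBalancedTensor _ _ op (fun s t => by
    change (s ⊗ₜ[k] (1 : Eᵐᵒᵖ)) * ((1 : E) ⊗ₜ[k] op t) = ((1 : E) ⊗ₜ[k] op t) * (s ⊗ₜ[k] 1)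
    simp) M

variable (k) in
/-- The underlying abelian group of `N ⊗_E X` only depends on `X` as a left module. -/
noncomputable def restrictTensorRightModule (N : ModuleCat.{u} Eᵐᵒᵖ) :
    ModuleCat.restrictScalars (Algebra.TensorProduct.includeLeftRingHom
        (R := k) (A := E) (B := Eᵐᵒᵖ)) ⋙
        (balancedTensor ((Int.castRingHom E).comp ULift.ringEquiv.{0, u}.toRingHom) unop N ⋙
          forget₂ (ModuleCat.{u} (ULift.{u} ℤ)) AddCommGrpCat.{u}) ≅
      tensorRightModule k N ⋙ forget₂ (ModuleCat.{u} Eᵐᵒᵖ) AddCommGrpCat.{u} :=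
  restrictBalancedTensor _ _ unop (fun s t => by
    change ((1 : E) ⊗ₜ[k] s) * (unop t ⊗ₜ[k] (1 : Eᵐᵒᵖ)) = (unop t ⊗ₜ[k] (1 : Eᵐᵒᵖ)) * (1 ⊗ₜ[k] s)
    simp) N

/-- The identity of the underlying group is a surjection from `M` to its twist, semilinear over
`σ⁻¹`. -/
theorem finite_restrictScalars (σ : E ≃ₐ[k] E) (M : ModuleCat.{u} E) [hM : Module.Finite E M] :
    Module.Finite E ((ModuleCat.restrictScalars σ.toAlgHom.toRingHom).obj M) := by
  have : RingHomSurjective σ.symm.toAlgHom.toRingHom := ⟨σ.symm.surjective⟩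
  let f : M →ₛₗ[σ.symm.toAlgHom.toRingHom]
      (ModuleCat.restrictScalars σ.toAlgHom.toRingHom).obj M :=
    { toFun := fun m => (show (ModuleCat.restrictScalars σ.toAlgHom.toRingHom).obj M from m)
      map_add' := fun _ _ => rfl
      map_smul' := fun a m => (congrArg (fun b : E => b • m) (σ.apply_symm_apply a)).symm }
  exact Module.Finite.of_surjective f (fun m => ⟨m, rfl⟩)

end Enveloping

end StrongPeriodicity

/-! ### The left and right statements -/

open StrongPeriodicity in
theorem lemma4p1 {k : Type v} [Field k] [IsAlgClosed k] {E : Type u} [Ring E] [Algebra k E]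
    [Module.Finite k E] (hE : StrongPeriodicity.IsSelfInjective E)
    [HasDerivedCategory.{w₁} (StrongPeriodicity.Bimod k E)]
    [HasDerivedCategory.{w₂} (ModuleCat.{u} E)] [HasDerivedCategory.{w₃} (ModuleCat.{u} Eᵐᵒᵖ)]
    (σ : E ≃ₐ[k] E) (n : ℕ) (hn : 0 < n)
    (α : Ext.{u} (StrongPeriodicity.regularBimod k E)
      (StrongPeriodicity.twistedBimod σ AlgEquiv.refl) n)
    (Y : DerivedCategory.Bounded (StrongPeriodicity.Bimod k E))
    (f : Y.obj ⟶ (DerivedCategory.singleFunctor _ 0).obj (StrongPeriodicity.regularBimod k E))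
    (δ : ((DerivedCategory.singleFunctor _ 0).obj
      (StrongPeriodicity.twistedBimod σ AlgEquiv.refl))⟦(n : ℤ)⟧ ⟶ Y.obj⟦(1 : ℤ)⟧)
    (hY : Pretriangulated.Triangle.mk f α.hom δ ∈
      distTriang (DerivedCategory (StrongPeriodicity.Bimod k E))) :
    (∀ M : ModuleCat.{u} E, Module.Finite E M →
      (StrongPeriodicity.IsStronglyPeriodic σ n α M ↔
        StrongPeriodicity.IsPerfect
          (StrongPeriodicity.derivedTensorLeftModule ⟨Y.obj, Y.property.2⟩ M))) ∧
    (∀ N : ModuleCat.{u} Eᵐᵒᵖ, Module.Finite Eᵐᵒᵖ N →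
      (StrongPeriodicity.IsStronglyPeriodicRight σ.symm n
          (α.comp (Ext.mk₀ (StrongPeriodicity.twistIso σ).hom) (add_zero n)) N ↔
        StrongPeriodicity.IsPerfect
          (StrongPeriodicity.derivedTensorRightModule N ⟨Y.obj, Y.property.2⟩))) := by
  constructor
  · intro M _
    have : IsArtinianRing E := .of_finite k E
    have : Module.Finite E (twistLeft σ M) := finite_restrictScalars σ M
    exact inducesStableIso_iff_isPerfect _ hE.1 _ _ α
      (isIso_leftDerivedToSingle _ _ (projective_restrictScalars_includeRight k E) _ _
        (restrictTensorLeftModule k M) projective_restrictScalars_includeRight_regularBimod _)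
      (isIso_leftDerivedToSingleShift _ _ (projective_restrictScalars_includeRight k E) _ _
        (restrictTensorLeftModule k M) (projective_restrictScalars_includeRight_twistedBimod σ) _ n)
      _ f δ hY
  · intro N _
    have : IsArtinianRing Eᵐᵒᵖ := .of_finite k Eᵐᵒᵖ
    have : Module.Finite Eᵐᵒᵖ (twistRight σ.symm N) :=
      finite_restrictScalars (AlgEquiv.op σ.symm) N
    -- Injectivity of `E` as a right module is carried to the regular `Eᵐᵒᵖ`-module along `x ↦ op
    -- x`, through Baer's criterion.
    have hR : Module.Injective Eᵐᵒᵖ Eᵐᵒᵖ :=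
      Module.Baer.iff_injective.1 ((Module.Baer.iff_injective.2 hE.2).of_equiv
        ({ MulOpposite.opAddEquiv with map_smul' := fun _ _ => rfl } : E ≃ₗ[Eᵐᵒᵖ] Eᵐᵒᵖ))
    refine inducesStableIso_iff_isPerfect _ hR _ _ _
      (isIso_leftDerivedToSingle _ _ (projective_restrictScalars_includeLeft k E) _ _
        (restrictTensorRightModule k N) projective_restrictScalars_includeLeft_regularBimod _)
      (isIso_leftDerivedToSingleShift _ _ (projective_restrictScalars_includeLeft k E) _ _
        (restrictTensorRightModule k N)
        (projective_restrictScalars_includeLeft_twistedBimod σ.symm) _ n)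
      _ f (((DerivedCategory.singleFunctor _ 0).map (twistIso σ).inv)⟦(n : ℤ)⟧' ≫ δ) ?_
    -- The triangle of `α` with its third vertex replaced along `_σE ≅ E_{σ⁻¹}`; the cocone `Y` is
    -- unchanged.
    refine Pretriangulated.isomorphic_distinguished _ hY _
      (Pretriangulated.Triangle.isoMk _ _ (Iso.refl _) (Iso.refl _)
        ((shiftFunctor _ (n : ℤ)).mapIso
          ((DerivedCategory.singleFunctor _ 0).mapIso (twistIso σ).symm)) ?_ ?_ ?_)
    · exact (Category.comp_id f).trans (Category.id_comp f).symm
    · change (α.comp (Ext.mk₀ (twistIso σ).hom) (add_zero n)).hom ≫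
        ((DerivedCategory.singleFunctor _ 0).map (twistIso σ).inv)⟦(n : ℤ)⟧' = 𝟙 _ ≫ α.hom
      rw [Category.id_comp, Ext.hom_comp_singleFunctor_map_shift,
        Ext.comp_assoc_of_third_deg_zero, Ext.mk₀_comp_mk₀, Iso.hom_inv_id, Ext.comp_mk₀_id]
    · change (((DerivedCategory.singleFunctor _ 0).map (twistIso σ).inv)⟦(n : ℤ)⟧' ≫ δ) ≫
        (𝟙 _)⟦(1 : ℤ)⟧' = ((DerivedCategory.singleFunctor _ 0).map (twistIso σ).inv)⟦(n : ℤ)⟧' ≫ δ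
      rw [CategoryTheory.Functor.map_id, Category.comp_id]
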